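/- Let $\mathcal X$ be a measurable space, let $D$ be a probability distribution of $(\bm x,y)$ on $\mathcal X\times\mathbb R$, let $c:\mathcal X\to[0,\infty)$ be a measurable cost function, let $\ell:\mathbb R\times\{-1,+1\}\to[0,\infty)$ be a binary loss, and let $\mathcal H$ and $\mathcal R$ be classes of measurable functions $\mathcal X\to\mathbb R$ (regressors and rejectors). Put $$\psi(h,r,c,\bm x,y)=(h(\bm x)-y)^2\,\ell(r(\bm x),-1)+c(\bm x)\,\ell(r(\bm x),+1),\qquad R^{\psi}(h,r)=\mathbb E_{(\bm x,y)\sim D}[\psi(h,r,c,\bm x,y)],$$ and $R^{\psi*}=\inf_{h\in\mathcal H,\,r\in\mathcal R}R^{\psi}(h,r)$. Let $(\bm x_1,y_1),\dots,(\bm x_n,y_n)$, $n\ge1$, be i.i.d. with law $D$, and write $\hat R^{\psi}(h,r)=\frac1n\sum_{i=1}^n\psi(h,r,c,\bm x_i,y_i)$. For a class $\mathcal F$ of real functions on $\mathcal X$ let $$\mathfrak R_n(\mathcal F)=\mathbb E_{\bm x_1,\dots,\bm x_n}\mathbb E_{\bm\sigma}\Big[\sup_{f\in\mathcal F}\frac1n\sum_{i=1}^n\sigma_if(\bm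 x_i)\Big]\in[0,\infty]$$ be its Rademacher complexity, where $\sigma_1,\dots,\sigma_n$ are independent and uniform on $\{-1,+1\}$. Assume that the classes are such that the suprema over $\mathcal H$ and over $\mathcal R$ of the sums $\sum_i a_if(\bm x_i)$, and the suprema over $\mathcal H\times\mathcal R$ of the sums $\sum_i a_i\big(\psi(h,r,c,\bm x_i,y_i)-R^\psi(h,r)\big)$, are measurable up to null sets, for all numbers of i.i.d. points and all real weights $a_i$. Suppose that, for constants $M_1,M_2>0$ and $\rho\ge0$, one has $0\le\ell\le M_1$, both functions $\ell(\cdot,\pm1)$ are $\rho$-Lipschitz, $|h|\le M_2$ for all $h\in\mathcal H$, $0\le c\le M_2$, and $|y|\le M_2$ almost surely. Let $0<\delta<1$. Then, with probability at least $1-\delta$, all minimizers $(\hat h,\hat r)$ of $\hat R^{\psi}$ over $\mathcal H\times\mathcal R$ satisfy $$R^{\psi}(\hat h,\hat r)-R^{\psi*}\le 2\sqrt2\,L_1\big(\mathfrak R_n(\mathcal H)+\mathfrak R_n(\mathcal R)\big)+C_1\sqrt{\frac{2\log(2/\delta)}{n}},$$ where $C_1=(4M_2^2+M_2)M_1$ and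 $L_1=\sqrt{(4M_2^2\rho+M_2\rho)^2+16M_1^2M_2^2}$. -/

import Mathlib

open MeasureTheory ProbabilityTheory

namespace RcR

noncomputable section

/-- The surrogate loss `ψ(h, r, c, x, y) = (h(x) - y)² ℓ(r(x), -1) + c(x) ℓ(r(x), +1)` at the
example `z = (x, y)`. The labels `-1` (reject) and `+1` (accept) are the two elements of `ℤˣ`. -/
def surrogate {X : Type*} (ℓ : ℝ → ℤˣ → ℝ) (c h r : X → ℝ) (z : X × ℝ) : ℝ :=
  (h z.1 - z.2) ^ 2 * ℓ (r z.1) (-1) + c z.1 * ℓ (r z.1) 1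

/-- The expected surrogate risk of `(h, r)` under the data distribution `D`. -/
def risk {X : Type*} [MeasurableSpace X] (D : Measure (X × ℝ)) (ℓ : ℝ → ℤˣ → ℝ)
    (c h r : X → ℝ) : ℝ :=
  ∫ z, surrogate ℓ c h r z ∂D

/-- The empirical surrogate risk of `(h, r)` on the sample `S`. -/
def empRisk {X : Type*} {n : ℕ} (S : Fin n → X × ℝ) (ℓ : ℝ → ℤˣ → ℝ) (c h r : X → ℝ) : ℝ :=
  (n : ℝ)⁻¹ * ∑ i, surrogate ℓ c h r (S i)

/-- The optimal expected surrogate risk over `H × R`. -/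
def optRisk {X : Type*} [MeasurableSpace X] (D : Measure (X × ℝ)) (ℓ : ℝ → ℤˣ → ℝ)
    (c : X → ℝ) (H R : Set (X → ℝ)) : ℝ :=
  sInf {t : ℝ | ∃ h ∈ H, ∃ r ∈ R, t = risk D ℓ c h r}

/-- `(h, r)` minimizes the empirical surrogate risk on the sample `S` over `H × R`. -/
def IsERM {X : Type*} {n : ℕ} (S : Fin n → X × ℝ) (ℓ : ℝ → ℤˣ → ℝ) (c : X → ℝ)
    (H R : Set (X → ℝ)) (h r : X → ℝ) : Prop :=
  h ∈ H ∧ r ∈ R ∧ ∀ h' ∈ H, ∀ r' ∈ R, empRisk S ℓ c h r ≤ empRisk S ℓ c h' r'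

/-- The empirical Rademacher complexity of `F` at the points `z₁, …, zₙ`: the average over all
sign vectors `σ` of `sup_{f ∈ F} (1/n) ∑ σᵢ f(zᵢ)`. It takes values in `EReal`, so that the
supremum of an unbounded set is `∞`. -/
def empRademacher {Z : Type*} {n : ℕ} (F : Set (Z → ℝ)) (z : Fin n → Z) : EReal :=
  (((2 : ℝ) ^ n)⁻¹ : ℝ) *
    ∑ σ : Fin n → ℤˣ, ⨆ f ∈ F, (((n : ℝ)⁻¹ * ∑ i, ((σ i : ℤ) : ℝ) * f (z i) : ℝ) : EReal)

/-- The expected Rademacher complexity of `F` for `n` independent points drawn from `P`. The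
empirical complexity of a nonempty class is nonnegative, by averaging over the signs of a single
`f ∈ F`; so `EReal.toENNReal` loses nothing. -/
def rademacher {Z : Type*} [MeasurableSpace Z] (n : ℕ) (P : Measure Z) (F : Set (Z → ℝ)) :
    ENNReal :=
  ∫⁻ z : Fin n → Z, (empRademacher F z).toENNReal ∂(Measure.pi fun _ => P)

/-- `F` is a `P`-measurable class: the suprema over `F` of the weighted empirical sums
`∑ aᵢ f(zᵢ)` are measurable on the completion of the product space. -/
def IsMeasurableClass {Z : Type*} [MeasurableSpace Z] (P : Measure Z) (F : Set (Z → ℝ)) : Prop :=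
  ∀ (m : ℕ) (a : Fin m → ℝ),
    AEMeasurable (fun z : Fin m → Z => ⨆ f ∈ F, ((∑ i, a i * f (z i) : ℝ) : EReal))
      (Measure.pi fun _ => P)

/-- The centred surrogate losses `z ↦ ψ(h, r, c, z) - R^ψ(h, r)` for `(h, r) ∈ H × R`. -/
def centredLosses {X : Type*} [MeasurableSpace X] (D : Measure (X × ℝ)) (ℓ : ℝ → ℤˣ → ℝ)
    (c : X → ℝ) (H R : Set (X → ℝ)) : Set (X × ℝ → ℝ) :=
  {g | ∃ h ∈ H, ∃ r ∈ R, g = fun z => surrogate ℓ c h r z - risk D ℓ c h r}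

end

end RcR

/-! Clipping the response to `[-M₂, M₂]` changes the loss only on a null set and puts every loss in
`[0, C₁]` at every point. Fix a comparison pair `k = (h₀, r₀)` that is nearly optimal. For an
empirical minimizer, `n` times the excess risk over `k` is at most a single statistic of the sample:
the supremum of the summed deviations `∫ g - g(zᵢ)` over the class, plus the opposite deviation of
`k` alone (`risk_sub_risk_le_of_isERM`).

Altering one example changes the supremum by at most `C₁` and the term of `k` by at most `C₁`, so
one one-sided application of McDiarmid's inequality with differences `2 C₁` suffices
(`measure_deviation_ge_le`). The term of `k` has mean zero, so only the expected supremum has to be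
bounded. The concentration costs `log (1 / δ)`; the gap to `log (2 / δ)` pays for an infimum of the
risk that may not be attained.

A ghost sample and random swaps bound the expected supremum by twice a Rademacher average of the
loss class (`ofReal_integral_deviation_le`). The loss is Lipschitz in `(h(x), r(x))` with
coordinatewise constants `a` and `b`, and a vector contraction inequality with factor `a + b`
separates the two classes (`contraction_prod`). Finally `a + b ≤ √2 √(a² + b²) = √2 L₁`, which
together with the 2 of symmetrization is the constant `2√2 L₁`.

The suprema are measurable only up to null sets, so the exponential moment bound is proved for such
functions. Rejectors may be unbounded; where the sample sees this, the complexity is infinite and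
the contraction bound is trivial. -/

namespace RcR

/-! ### Bounded families and their suprema -/

/-- A real function with bounded range. -/
def BddFun {ι : Type*} (f : ι → ℝ) : Prop := ∃ B, ∀ j, |f j| ≤ B

namespace BddFun

variable {ι κ : Type*} {f g : ι → ℝ}

theorem add (hf : BddFun f) (hg : BddFun g) : BddFun fun j => f j + g j := by
  obtain ⟨A, hA⟩ := hf
  obtain ⟨B, hB⟩ := hg
  exact ⟨A + B, fun j => (abs_add_le _ _).trans (add_le_add (hA j) (hB j))⟩

theorem const_mul (hf : BddFun f) (a : ℝ) : BddFun fun j => a * f j := by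
  obtain ⟨A, hA⟩ := hf
  exact ⟨|a| * A, fun j => by
    rw [abs_mul]; exact mul_le_mul_of_nonneg_left (hA j) (abs_nonneg a)⟩

theorem const (a : ℝ) : BddFun fun _ : ι => a := ⟨|a|, fun _ => le_rfl⟩

theorem sum {s : Finset κ} {F : ι → κ → ℝ} (hF : ∀ i ∈ s, BddFun fun j => F j i) :
    BddFun fun j => ∑ i ∈ s, F j i := by
  classical
  induction s using Finset.induction_on with
  | empty => simpa using const 0
  | insert i s hi ih =>
    simp only [Finset.sum_insert hi]
    exact (hF i (by simp)).add (ih fun k hk => hF k (by simp [hk]))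

theorem bddAbove (hf : BddFun f) : BddAbove (Set.range f) := by
  obtain ⟨A, hA⟩ := hf
  exact ⟨A, by rintro _ ⟨j, rfl⟩; exact (abs_le.1 (hA j)).2⟩

/-- A real `⨆` over a family unbounded above takes the default value 0, so boundedness has to
accompany every supremum. -/
theorem le_ciSup (hf : BddFun f) (j : ι) : f j ≤ ⨆ j, f j := _root_.le_ciSup hf.bddAbove j

theorem comp (hf : BddFun f) (e : κ → ι) : BddFun fun j => f (e j) := by
  obtain ⟨A, hA⟩ := hf
  exact ⟨A, fun j => hA (e j)⟩

end BddFun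

theorem sum_intUnits (f : ℤˣ → ℝ) : ∑ s, f s = f 1 + f (-1) := by
  rw [show (Finset.univ : Finset ℤˣ) = {1, -1} from rfl, Finset.sum_pair (by decide)]

theorem add_ciSup_le {ι : Type*} [Nonempty ι] {f g : ι → ℝ} {A : ℝ}
    (h : ∀ j k, f j + g k ≤ A) : (⨆ j, f j) + (⨆ k, g k) ≤ A := by
  rw [← le_sub_iff_add_le]
  refine ciSup_le fun j => ?_
  rw [le_sub_comm]
  exact ciSup_le fun k => by linarith [h j k]

/-! ### Vector contraction for Rademacher sums -/

/-- One step of the vector contraction inequality: a single sign in front of a function that is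
Lipschitz in `(u, v)` is replaced by two independent signs in front of `u` and `v`. -/
theorem contraction_step {ι : Type*} [Nonempty ι] {a b α : ℝ} (ha : 0 ≤ a) (hb : 0 ≤ b)
    (hab : a + b ≤ α) {G u v w : ι → ℝ} (hG : BddFun G) (hu : BddFun u) (hv : BddFun v)
    (hw : ∀ j k, |w j - w k| ≤ a * |u j - u k| + b * |v j - v k|) :
    2 * ∑ s : ℤˣ, ⨆ j, (G j + ((s : ℤ) : ℝ) * w j) ≤
      ∑ s : ℤˣ, ∑ t : ℤˣ, ⨆ j, (G j + α * (((s : ℤ) : ℝ) * u j + ((t : ℤ) : ℝ) * v j)) := by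
  have key : ∀ s t : ℤˣ, BddFun fun j =>
      G j + α * (((s : ℤ) : ℝ) * u j + ((t : ℤ) : ℝ) * v j) := fun s t =>
    hG.add (((hu.const_mul _).add (hv.const_mul _)).const_mul _)
  have hle := fun s t j => (key s t).le_ciSup j
  simp only [sum_intUnits] at *
  rw [← le_div_iff₀' two_pos]
  refine add_ciSup_le fun j k => ?_
  -- `w j - w k` is at most `α` times the larger of the two coordinate gaps. If that is the `u` gap
  -- and `u j ≥ u k`, evaluate at `j` both suprema with `s = 1` and at `k` both with `s = -1`: the
  -- `v` terms cancel and `2 α (u j - u k)` remains. The other three cases exchange `j` with `k` or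
  -- `u` with `v`.
  have h1 := hle 1 1 j
  have h2 := hle (-1) (-1) k
  have h3 := hle 1 1 k
  have h4 := hle (-1) (-1) j
  have h5 := hle 1 (-1) j
  have h6 := hle (-1) 1 k
  have h7 := hle 1 (-1) k
  have h8 := hle (-1) 1 j
  have hα : 0 ≤ α := by linarith
  have hwjk := (le_abs_self _).trans (hw j k)
  simp only [Units.val_one, Units.val_neg, Int.cast_one, Int.cast_neg, one_mul, neg_mul] at *
  rw [le_div_iff₀' two_pos]
  have hmax : a * |u j - u k| + b * |v j - v k| ≤ α * max |u j - u k| |v j - v k| := by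
    have := mul_le_mul_of_nonneg_left (le_max_left |u j - u k| |v j - v k|) ha
    have := mul_le_mul_of_nonneg_left (le_max_right |u j - u k| |v j - v k|) hb
    have := mul_le_mul_of_nonneg_right hab
      ((abs_nonneg _).trans (le_max_left |u j - u k| |v j - v k|))
    linarith
  have hwm := hwjk.trans hmax
  rcases max_cases |u j - u k| |v j - v k| with ⟨h, -⟩ | ⟨h, -⟩ <;> rw [h] at hwm
  · rcases abs_cases (u j - u k) with ⟨h, -⟩ | ⟨h, -⟩ <;> rw [h] at hwm <;> linarith
  · rcases abs_cases (v j - v k) with ⟨h, -⟩ | ⟨h, -⟩ <;> rw [h] at hwm <;> linarith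

theorem sum_fin_succ_fun {n : ℕ} (f : (Fin (n + 1) → ℤˣ) → ℝ) :
    ∑ σ, f σ = ∑ s : ℤˣ, ∑ σ : Fin n → ℤˣ, f (Fin.cons s σ) := by
  rw [← Fintype.sum_prod_type', ← (Fin.consEquiv fun _ : Fin (n + 1) => ℤˣ).sum_comp]
  rfl

/-- The vector contraction inequality for Rademacher averages, with an additional offset `G`. -/
theorem contraction_offset {ι : Type*} [Nonempty ι] {a b α : ℝ} (ha : 0 ≤ a) (hb : 0 ≤ b)
    (hab : a + b ≤ α) : ∀ (n : ℕ) {G : ι → ℝ} {u v w : ι → Fin n → ℝ}, BddFun G →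
    (∀ i, BddFun fun j => u j i) → (∀ i, BddFun fun j => v j i) → (∀ i, BddFun fun j => w j i) →
    (∀ i j k, |w j i - w k i| ≤ a * |u j i - u k i| + b * |v j i - v k i|) →
    2 ^ n * ∑ σ : Fin n → ℤˣ, ⨆ j, (G j + ∑ i, ((σ i : ℤ) : ℝ) * w j i) ≤
      ∑ σ : Fin n → ℤˣ, ∑ τ : Fin n → ℤˣ,
        ⨆ j, (G j + ∑ i, α * (((σ i : ℤ) : ℝ) * u j i + ((τ i : ℤ) : ℝ) * v j i)) := by
  intro n
  induction n with
  | zero => intro G u v w _ _ _ _ _; simp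
  | succ n ih =>
    intro G u v w hG hu hv hw hL
    simp only [sum_fin_succ_fun, Fin.sum_univ_succ, Fin.cons_zero, Fin.cons_succ, ← add_assoc]
    -- The offset drives the induction: the head term is put in it while the tail is contracted,
    -- then the contracted tail is put in it while the head is.
    calc _ = 2 * ∑ s : ℤˣ, 2 ^ n * ∑ σ : Fin n → ℤˣ,
            ⨆ j, (G j + ((s : ℤ) : ℝ) * w j 0 + ∑ i, ((σ i : ℤ) : ℝ) * w j (Fin.succ i)) := by
          rw [pow_succ', mul_assoc, Finset.mul_sum]
      _ ≤ 2 * ∑ s : ℤˣ, ∑ σ : Fin n → ℤˣ, ∑ τ : Fin n → ℤˣ,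
            ⨆ j, (G j + ((s : ℤ) : ℝ) * w j 0 + ∑ i, α * (((σ i : ℤ) : ℝ) * u j (Fin.succ i) +
              ((τ i : ℤ) : ℝ) * v j (Fin.succ i))) := by
          gcongr with s _
          exact ih (hG.add ((hw 0).const_mul _)) (fun i => hu _) (fun i => hv _) (fun i => hw _)
            fun i => hL _
      _ = ∑ σ : Fin n → ℤˣ, ∑ τ : Fin n → ℤˣ, 2 * ∑ s : ℤˣ,
            ⨆ j, (G j + (∑ i, α * (((σ i : ℤ) : ℝ) * u j (Fin.succ i) +
              ((τ i : ℤ) : ℝ) * v j (Fin.succ i))) + ((s : ℤ) : ℝ) * w j 0) := by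
          simp only [← Finset.mul_sum]
          rw [Finset.sum_comm]
          congr 1
          refine Finset.sum_congr rfl fun σ _ => ?_
          rw [Finset.sum_comm]
          simp only [add_right_comm]
      _ ≤ ∑ σ : Fin n → ℤˣ, ∑ τ : Fin n → ℤˣ, ∑ s : ℤˣ, ∑ t : ℤˣ,
            ⨆ j, (G j + (∑ i, α * (((σ i : ℤ) : ℝ) * u j (Fin.succ i) +
              ((τ i : ℤ) : ℝ) * v j (Fin.succ i))) +
                α * (((s : ℤ) : ℝ) * u j 0 + ((t : ℤ) : ℝ) * v j 0)) := by
          gcongr with σ _ τ _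
          refine contraction_step ha hb hab (hG.add (BddFun.sum fun i _ => ?_)) (hu 0) (hv 0) (hL 0)
          exact (((hu _).const_mul _).add ((hv _).const_mul _)).const_mul _
      _ = _ := by
          have : ∀ F : (Fin n → ℤˣ) → (Fin n → ℤˣ) → ℤˣ → ℤˣ → ℝ,
              ∑ σ, ∑ τ, ∑ s, ∑ t, F σ τ s t = ∑ s, ∑ σ, ∑ t, ∑ τ, F σ τ s t := fun F => by
            simp_rw [Finset.sum_comm (s := (Finset.univ : Finset (Fin n → ℤˣ)))
              (t := (Finset.univ : Finset ℤˣ))]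
          rw [this]
          simp only [add_right_comm]

/-- The vector contraction inequality on a product class. -/
theorem contraction_prod {ι κ : Type*} [Nonempty ι] [Nonempty κ] {a b α : ℝ} (ha : 0 ≤ a)
    (hb : 0 ≤ b) (hab : a + b ≤ α) {n : ℕ} {u : ι → Fin n → ℝ} {v : κ → Fin n → ℝ}
    {w : ι × κ → Fin n → ℝ} (hu : ∀ i, BddFun fun j => u j i) (hv : ∀ i, BddFun fun j => v j i)
    (hw : ∀ i, BddFun fun j => w j i)
    (hL : ∀ i j k, |w j i - w k i| ≤ a * |u j.1 i - u k.1 i| + b * |v j.2 i - v k.2 i|) :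
    ∑ σ : Fin n → ℤˣ, ⨆ j, ∑ i, ((σ i : ℤ) : ℝ) * w j i ≤
      α * ((∑ σ : Fin n → ℤˣ, ⨆ j, ∑ i, ((σ i : ℤ) : ℝ) * u j i) +
        ∑ σ : Fin n → ℤˣ, ⨆ j, ∑ i, ((σ i : ℤ) : ℝ) * v j i) := by
  have h := contraction_offset ha hb hab n (BddFun.const 0) (fun i => (hu i).comp Prod.fst)
    (fun i => (hv i).comp Prod.snd) hw hL
  simp only [zero_add] at h
  have hα : 0 ≤ α := by linarith
  have hsplit : ∀ σ τ : Fin n → ℤˣ,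
      ⨆ j : ι × κ, ∑ i, α * (((σ i : ℤ) : ℝ) * u j.1 i + ((τ i : ℤ) : ℝ) * v j.2 i) ≤
      α * ((⨆ j, ∑ i, ((σ i : ℤ) : ℝ) * u j i) + ⨆ j, ∑ i, ((τ i : ℤ) : ℝ) * v j i) := by
    intro σ τ
    refine ciSup_le fun j => ?_
    rw [← Finset.mul_sum, Finset.sum_add_distrib]
    have h1 : BddFun fun j => ∑ i, ((σ i : ℤ) : ℝ) * u j i :=
      BddFun.sum fun i _ => (hu i).const_mul _
    have h2 : BddFun fun j => ∑ i, ((τ i : ℤ) : ℝ) * v j i :=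
      BddFun.sum fun i _ => (hv i).const_mul _
    exact mul_le_mul_of_nonneg_left (add_le_add (h1.le_ciSup j.1) (h2.le_ciSup j.2)) hα
  have h' := h.trans (Finset.sum_le_sum fun σ _ => Finset.sum_le_sum fun τ _ => hsplit σ τ)
  -- Each of the two suprema depends on one sign vector only; summing over the other gives `2 ^ n`,
  -- which cancels the factor on the left.
  simp only [← Finset.mul_sum, Finset.sum_add_distrib, Finset.sum_const, Finset.card_univ,
    Fintype.card_pi, Fintype.card_units_int, Finset.prod_const, Fintype.card_fin, nsmul_eq_mul,
    Nat.cast_pow, Nat.cast_ofNat, ← mul_add] at h'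
  rw [mul_left_comm] at h'
  exact le_of_mul_le_mul_left h' (by positivity)

/-! ### Exponential moments and McDiarmid's inequality -/

/-- Hoeffding's lemma in the form `∫ exp (t X) ≤ exp (t ∫ X + t² c² / 8)` for a random variable
whose oscillation is at most `c`. -/
theorem integral_exp_mul_le_of_osc {Z : Type*} [MeasurableSpace Z] {μ : Measure Z}
    [IsProbabilityMeasure μ] {f : Z → ℝ} (hf : AEMeasurable f μ) {c : ℝ}
    (hc : ∀ x y, f x ≤ f y + c) (t : ℝ) :
    ∫ x, Real.exp (t * f x) ∂μ ≤ Real.exp (t * ∫ x, f x ∂μ + t ^ 2 * c ^ 2 / 8) := by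
  obtain ⟨y₀⟩ : Nonempty Z := nonempty_of_isProbabilityMeasure μ
  have hbdd : BddBelow (Set.range f) :=
    ⟨f y₀ - c, by rintro _ ⟨x, rfl⟩; linarith [hc y₀ x]⟩
  have hmem : ∀ᵐ x ∂μ, f x ∈ Set.Icc (⨅ y, f y) ((⨅ y, f y) + c) := by
    refine Filter.Eventually.of_forall fun x => ⟨ciInf_le hbdd x, ?_⟩
    rw [← sub_le_iff_le_add]
    have : Nonempty Z := ⟨y₀⟩
    exact le_ciInf fun y => by linarith [hc x y]
  have h := (hasSubgaussianMGF_of_mem_Icc hf hmem).mgf_le t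
  have hcoe : (((‖((⨅ y, f y) + c) - ⨅ y, f y‖₊ / 2) ^ 2 : NNReal) : ℝ) = c ^ 2 / 4 := by
    simp only [add_sub_cancel_left, NNReal.coe_pow, NNReal.coe_div, coe_nnnorm, Real.norm_eq_abs,
      NNReal.coe_ofNat, div_pow, sq_abs]
    norm_num
  rw [hcoe, mgf] at h
  have hsplit : ∀ x, Real.exp (t * f x) =
      Real.exp (t * ∫ x, f x ∂μ) * Real.exp (t * (f x - ∫ x, f x ∂μ)) := fun x => by
    rw [← Real.exp_add]; ring_nf
  simp only [hsplit]
  rw [integral_const_mul, Real.exp_add]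
  refine mul_le_mul_of_nonneg_left (h.trans (le_of_eq ?_)) (Real.exp_pos _).le
  ring_nf

/-- The exponential moment bound of McDiarmid's bounded differences inequality, for functions that
are measurable only up to null sets. -/
theorem integral_exp_mul_le_of_boundedDiff {Z : Type*} [MeasurableSpace Z] (D : Measure Z)
    [IsProbabilityMeasure D] (c B t : ℝ) : ∀ (n : ℕ) (f : (Fin n → Z) → ℝ),
    AEMeasurable f (Measure.pi fun _ => D) → (∀ z, |f z| ≤ B) →
    (∀ z i x, f z ≤ f (Function.update z i x) + c) →
    ∫ z, Real.exp (t * f z) ∂(Measure.pi fun _ => D) ≤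
      Real.exp (t * ∫ z, f z ∂(Measure.pi fun _ => D) + n * (t ^ 2 * c ^ 2 / 8)) := by
  intro n
  induction n with
  | zero =>
    intro f _ _ _
    have hf0 : ∀ z, f z = f default := fun z => congrArg f (Subsingleton.elim _ _)
    simp [hf0]
  | succ n ih =>
    intro f hf hB hd
    have hmp := (measurePreserving_piFinSuccAbove (fun _ : Fin (n + 1) => D) 0).symm
    set e := (MeasurableEquiv.piFinSuccAbove (fun _ : Fin (n + 1) => Z) 0).symm with he
    have hecons : ∀ p, e p = Fin.cons p.1 p.2 := fun p => by
      simp [he, MeasurableEquiv.piFinSuccAbove, Fin.insertNthEquiv]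
    set Q : Measure (Fin n → Z) := Measure.pi fun _ => D
    have hfe : AEMeasurable (fun p => f (e p)) (D.prod Q) :=
      hf.comp_quasiMeasurePreserving hmp.quasiMeasurePreserving
    have hfs : AEMeasurable (fun p : (Fin n → Z) × Z => f (e (p.2, p.1))) (Q.prod D) :=
      hfe.comp_quasiMeasurePreserving Measure.measurePreserving_swap.quasiMeasurePreserving
    have hB0 : 0 ≤ B := (abs_nonneg _).trans
      (hB (fun _ => (nonempty_of_isProbabilityMeasure D).some))
    -- the upper integral over the first coordinate, defined at every point
    set I : (Fin n → Z) → ENNReal := fun w => ∫⁻ x, ENNReal.ofReal (f (e (x, w)) + B) ∂D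
    -- On a non-measurable slice the Bochner integral would default to 0 and could destroy the
    -- bounded differences of `F`, which the induction needs at every point. `∫⁻` of the nonnegative
    -- `f + B` stays monotone there and agrees with the Bochner integral on almost every slice.
    set F : (Fin n → Z) → ℝ := fun w => (I w).toReal - B with hF
    have hI_le : ∀ w, I w ≤ ENNReal.ofReal (2 * B) := fun w => by
      calc I w ≤ ∫⁻ _, ENNReal.ofReal (2 * B) ∂D :=
            lintegral_mono fun x => ENNReal.ofReal_le_ofReal
              (by linarith [(abs_le.1 (hB (e (x, w)))).2])
        _ = _ := by simp
    have hI_top : ∀ w, I w ≠ ⊤ := fun w => ((hI_le w).trans_lt ENNReal.ofReal_lt_top).ne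
    have hIm : AEMeasurable I Q :=
      AEMeasurable.lintegral_prod_right' (f := fun p => ENNReal.ofReal (f (e (p.2, p.1)) + B))
        (hfs.add_const B).ennreal_ofReal
    have hFm : AEMeasurable F Q := hIm.ennreal_toReal.sub_const B
    have hFB : ∀ w, |F w| ≤ B := fun w => by
      have h1 : (I w).toReal ≤ 2 * B := ENNReal.toReal_le_of_le_ofReal (by linarith) (hI_le w)
      have h2 : 0 ≤ (I w).toReal := ENNReal.toReal_nonneg
      rw [abs_le]; constructor <;> simp only [hF] <;> linarith
    have hc0 : 0 ≤ c := by
      have := hd (fun _ => (nonempty_of_isProbabilityMeasure D).some) 0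
        (nonempty_of_isProbabilityMeasure D).some
      rw [Function.update_eq_self_iff.2 rfl] at this
      linarith
    have hFd : ∀ w i x, F w ≤ F (Function.update w i x) + c := fun w i x => by
      have : I w ≤ I (Function.update w i x) + ENNReal.ofReal c := by
        calc I w ≤ ∫⁻ y, (ENNReal.ofReal (f (e (y, Function.update w i x)) + B) +
                ENNReal.ofReal c) ∂D := by
              refine lintegral_mono fun y => ?_
              rw [← ENNReal.ofReal_add
                (by linarith [(abs_le.1 (hB (e (y, Function.update w i x)))).1]) hc0]
              refine ENNReal.ofReal_le_ofReal ?_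
              have := hd (e (y, w)) i.succ x
              rw [hecons, ← Fin.cons_update, ← hecons, ← hecons (y, Function.update w i x)] at this
              linarith
          _ = _ := by
              rw [lintegral_add_right _ measurable_const]; simp [I]
      have h := ENNReal.toReal_mono (by simp [hI_top]) this
      rw [ENNReal.toReal_add (hI_top _) ENNReal.ofReal_ne_top, ENNReal.toReal_ofReal hc0] at h
      simp only [hF]; linarith
    have hslice : ∀ᵐ w ∂Q, AEMeasurable (fun x => f (e (x, w))) D := by
      filter_upwards [hfs.aestronglyMeasurable.prodMk_left] with w hw using hw.aemeasurable
    have hFint : ∀ w, AEMeasurable (fun x => f (e (x, w))) D → ∫ x, f (e (x, w)) ∂D = F w := by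
      intro w hw
      have hint : Integrable (fun x => f (e (x, w))) D :=
        Integrable.of_bound hw.aestronglyMeasurable B (Filter.Eventually.of_forall fun x => hB _)
      have h := integral_eq_lintegral_of_nonneg_ae (μ := D) (f := fun x => f (e (x, w)) + B)
        (Filter.Eventually.of_forall fun x => by
          simp only [Pi.zero_apply]; linarith [(abs_le.1 (hB (e (x, w)))).1])
        (hw.add_const B).aestronglyMeasurable
      rw [integral_add hint (integrable_const _)] at h
      simp only [integral_const, probReal_univ, smul_eq_mul, one_mul] at h
      simp only [hF, I]; linarith
    have hfint : Integrable (fun p : (Fin n → Z) × Z => f (e (p.2, p.1))) (Q.prod D) :=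
      Integrable.of_bound hfs.aestronglyMeasurable B (Filter.Eventually.of_forall fun x => hB _)
    have hexpB : ∀ s, |s| ≤ B → ‖Real.exp (t * s)‖ ≤ Real.exp (|t| * B) := fun s hs => by
      rw [Real.norm_eq_abs, Real.abs_exp, Real.exp_le_exp]
      exact (le_abs_self _).trans (by rw [abs_mul]; gcongr)
    have hexpint : Integrable (fun p : (Fin n → Z) × Z => Real.exp (t * f (e (p.2, p.1))))
        (Q.prod D) :=
      Integrable.of_bound (Real.measurable_exp.comp_aemeasurable
        (hfs.const_mul t)).aestronglyMeasurable _ (Filter.Eventually.of_forall fun x => hexpB _ (hB _))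
    have hmean : ∫ z, f z ∂(Measure.pi fun _ => D) = ∫ w, F w ∂Q := by
      rw [← hmp.integral_comp', ← integral_prod_swap]
      refine (integral_prod _ hfint).trans ?_
      refine integral_congr_ae ?_
      filter_upwards [hslice] with w hw using hFint w hw
    rw [hmean]
    -- Hoeffding's lemma applies to the first coordinate on almost every slice, and the induction
    -- hypothesis to the slice means `F`.
    calc ∫ z, Real.exp (t * f z) ∂(Measure.pi fun _ => D)
        = ∫ w, ∫ x, Real.exp (t * f (e (x, w))) ∂D ∂Q := by
          rw [← hmp.integral_comp', ← integral_prod_swap]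
          exact integral_prod _ hexpint
      _ ≤ ∫ w, Real.exp (t * F w) * Real.exp (t ^ 2 * c ^ 2 / 8) ∂Q := by
          refine integral_mono_ae hexpint.integral_prod_left ?_ ?_
          · exact (Integrable.of_bound (Real.measurable_exp.comp_aemeasurable
              (hFm.const_mul t)).aestronglyMeasurable _
              (Filter.Eventually.of_forall fun x => hexpB _ (hFB x))).mul_const _
          · filter_upwards [hslice] with w hw
            rw [← Real.exp_add, ← hFint w hw]
            refine integral_exp_mul_le_of_osc hw (fun x y => ?_) t
            have := hd (e (x, w)) 0 y
            rw [hecons, Fin.update_cons_zero, ← hecons, ← hecons (y, w)] at this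
            exact this
      _ ≤ Real.exp (t * ∫ w, F w ∂Q + n * (t ^ 2 * c ^ 2 / 8)) * Real.exp (t ^ 2 * c ^ 2 / 8) := by
          rw [integral_mul_const]
          exact mul_le_mul_of_nonneg_right (ih F hFm hFB hFd) (Real.exp_pos _).le
      _ = _ := by
          rw [← Real.exp_add]; push_cast; ring_nf

/-- **McDiarmid's inequality** for functions that are measurable up to null sets. -/
theorem measure_ge_le_of_boundedDiff {Z : Type*} [MeasurableSpace Z] (D : Measure Z)
    [IsProbabilityMeasure D] {c B : ℝ} (hc : 0 < c) {n : ℕ} (hn : 0 < n) {f : (Fin n → Z) → ℝ}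
    (hf : AEMeasurable f (Measure.pi fun _ => D)) (hB : ∀ z, |f z| ≤ B)
    (hd : ∀ z i x, f z ≤ f (Function.update z i x) + c) {ε : ℝ} (hε : 0 ≤ ε) :
    (Measure.pi fun _ => D).real
        {z | ∫ z, f z ∂(Measure.pi fun _ => D) + ε ≤ f z} ≤
      Real.exp (-(2 * ε ^ 2 / (n * c ^ 2))) := by
  set Q : Measure (Fin n → Z) := Measure.pi fun _ => D
  have hn' : (0 : ℝ) < n := by exact_mod_cast hn
  -- The minimizer of the Chernoff exponent `-t ε + n t² c² / 8`.
  set t : ℝ := 4 * ε / (n * c ^ 2) with ht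
  have ht0 : 0 ≤ t := by positivity
  have hint : Integrable (fun z => Real.exp (t * f z)) Q := by
    refine Integrable.of_bound (Real.measurable_exp.comp_aemeasurable
      (hf.const_mul t)).aestronglyMeasurable (Real.exp (|t| * B))
      (Filter.Eventually.of_forall fun z => ?_)
    rw [Real.norm_eq_abs, Real.abs_exp, Real.exp_le_exp]
    exact (le_abs_self _).trans (by rw [abs_mul]; gcongr; exact hB z)
  refine (measure_ge_le_exp_mul_mgf (∫ z, f z ∂Q + ε) ht0 hint).trans ?_
  refine (mul_le_mul_of_nonneg_left (integral_exp_mul_le_of_boundedDiff D c B t n f hf hB hd)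
    (Real.exp_pos _).le).trans ?_
  rw [← Real.exp_add, Real.exp_le_exp]
  apply le_of_eq
  rw [ht]
  field_simp
  ring

/-! ### Symmetrization with a ghost sample -/

theorem ofReal_integral_le_lintegral {Z : Type*} [MeasurableSpace Z] {μ : Measure Z} {f : Z → ℝ}
    (hf : Integrable f μ) : ENNReal.ofReal (∫ x, f x ∂μ) ≤ ∫⁻ x, ENNReal.ofReal (f x) ∂μ := by
  rw [integral_eq_lintegral_pos_part_sub_lintegral_neg_part hf]
  exact (ENNReal.ofReal_le_ofReal (sub_le_self _ ENNReal.toReal_nonneg)).trans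
    ENNReal.ofReal_toReal_le

theorem abs_ciSup_le {ι : Type*} [Nonempty ι] {f : ι → ℝ} {B : ℝ} (hf : ∀ j, |f j| ≤ B) :
    |⨆ j, f j| ≤ B := by
  obtain ⟨j⟩ : Nonempty ι := inferInstance
  have hb : BddFun f := ⟨B, hf⟩
  exact abs_le.2 ⟨(abs_le.1 (hf j)).1.trans (hb.le_ciSup j), ciSup_le fun j => (abs_le.1 (hf j)).2⟩

theorem piCongrLeft_const_apply {Z κ κ' : Type*} [MeasurableSpace Z] (e : κ ≃ κ') (w : κ → Z)
    (i : κ') : MeasurableEquiv.piCongrLeft (fun _ => Z) e w i = w (e.symm i) := by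
  obtain ⟨k, rfl⟩ := e.surjective i
  rw [MeasurableEquiv.coe_piCongrLeft, Equiv.piCongrLeft_apply_apply, e.symm_apply_apply]

theorem lintegral_comp_of_aemeasurable {Y Z : Type*} [MeasurableSpace Y] [MeasurableSpace Z]
    {μ : Measure Y} {ν : Measure Z} {T : Y → Z} (hT : MeasurePreserving T μ ν) {W : Z → ENNReal}
    (hW : AEMeasurable W ν) : ∫⁻ y, W (T y) ∂μ = ∫⁻ z, W z ∂ν := by
  obtain ⟨rfl⟩ := hT.map_eq
  exact (lintegral_map' hW hT.measurable.aemeasurable).symm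

theorem abs_signed_sub_le {Z ι : Type*} {g : ι → Z → ℝ} {C : ℝ} (hC : ∀ j x, |g j x| ≤ C)
    (s : ℤˣ) (j : ι) (x y : Z) :
    |((s : ℤ) : ℝ) * (g j x - g j y)| ≤ 2 * C := by
  have h : |g j x - g j y| ≤ 2 * C :=
    (abs_sub _ _).trans (by linarith [hC j x, hC j y])
  rcases Int.units_eq_one_or s with rfl | rfl <;> simpa [abs_sub_comm] using h

/-- The supremum of a difference is at most the sum of two suprema, the second with signs `-σ`; the
average over all signs is invariant under `σ ↦ -σ`. -/
theorem signed_average_le {Z ι : Type*} [Nonempty ι] {g : ι → Z → ℝ} {C : ℝ}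
    (hC : ∀ j x, |g j x| ≤ C) {n : ℕ} (w : Fin n ⊕ Fin n → Z) :
    (2 ^ n)⁻¹ * ∑ σ : Fin n → ℤˣ,
        ⨆ j, ∑ i, ((σ i : ℤ) : ℝ) * (g j (w (.inr i)) - g j (w (.inl i))) ≤
      (2 ^ n)⁻¹ * (∑ σ : Fin n → ℤˣ, ⨆ j, ∑ i, ((σ i : ℤ) : ℝ) * g j (w (.inr i))) +
      (2 ^ n)⁻¹ * ∑ σ : Fin n → ℤˣ, ⨆ j, ∑ i, ((σ i : ℤ) : ℝ) * g j (w (.inl i)) := by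
  have hbdd : ∀ (z : Fin n → Z) (σ : Fin n → ℤˣ),
      BddFun fun j => ∑ i, ((σ i : ℤ) : ℝ) * g j (z i) := fun z σ =>
    BddFun.sum fun i _ => BddFun.const_mul ⟨C, fun j => hC j _⟩ _
  have hneg : ∑ σ : Fin n → ℤˣ, ⨆ j, ∑ i, (((-σ) i : ℤ) : ℝ) * g j (w (.inl i)) =
      ∑ σ : Fin n → ℤˣ, ⨆ j, ∑ i, ((σ i : ℤ) : ℝ) * g j (w (.inl i)) :=
    Equiv.sum_comp (Equiv.neg (Fin n → ℤˣ))
      (fun σ => ⨆ j, ∑ i, ((σ i : ℤ) : ℝ) * g j (w (.inl i)))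
  rw [← mul_add, ← hneg, ← Finset.sum_add_distrib]
  gcongr with σ _
  refine ciSup_le fun j => ?_
  have h1 := (hbdd (fun i => w (.inr i)) σ).le_ciSup j
  have h2 := (hbdd (fun i => w (.inl i)) (-σ)).le_ciSup j
  refine le_trans (le_of_eq ?_) (add_le_add h1 h2)
  rw [← Finset.sum_add_distrib]
  refine Finset.sum_congr rfl fun i _ => ?_
  simp only [Pi.neg_apply, Units.val_neg, Int.cast_neg]
  ring

section Symmetrization

variable {Z ι : Type*} [MeasurableSpace Z] {D : Measure Z} {g : ι → Z → ℝ} {C : ℝ}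

/-- Measurability of the suprema of weighted sums over `Fin m` gives it over any finite type. -/
theorem aemeasurable_ciSup_fintype [IsProbabilityMeasure D]
    (hm : ∀ (m : ℕ) (a : Fin m → ℝ), AEMeasurable
      (fun z : Fin m → Z => ⨆ j, ∑ i, a i * (g j (z i) - ∫ x, g j x ∂D)) (Measure.pi fun _ => D))
    {κ : Type*} [Fintype κ] (a : κ → ℝ) :
    AEMeasurable (fun z : κ → Z => ⨆ j, ∑ i, a i * (g j (z i) - ∫ x, g j x ∂D))
      (Measure.pi fun _ => D) := by
  have e := Fintype.equivFin κ
  have hmp := measurePreserving_piCongrLeft (fun _ : Fin (Fintype.card κ) => D) e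
  convert (hm _ fun i => a (e.symm i)).comp_quasiMeasurePreserving hmp.quasiMeasurePreserving
    using 1
  ext z
  refine congrArg iSup (funext fun j => ?_)
  rw [← e.sum_comp]
  refine Finset.sum_congr rfl fun i _ => ?_
  simp [piCongrLeft_const_apply]

theorem aemeasurable_deviation
    (hm : ∀ (m : ℕ) (a : Fin m → ℝ), AEMeasurable
      (fun z : Fin m → Z => ⨆ j, ∑ i, a i * (g j (z i) - ∫ x, g j x ∂D)) (Measure.pi fun _ => D))
    (n : ℕ) :
    AEMeasurable (fun z : Fin n → Z => ⨆ j, ∑ i, (∫ x, g j x ∂D - g j (z i)))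
      (Measure.pi fun _ => D) := by
  simpa using hm n fun _ => -1

/-- The involution of `κ ⊕ κ` that exchanges the two copies of `i` where `σ i = -1`. -/
def signSwap {κ : Type*} (σ : κ → ℤˣ) : Equiv.Perm (κ ⊕ κ) :=
  Function.Involutive.toPerm
    (Sum.elim (fun i => if σ i = 1 then .inl i else .inr i)
      (fun i => if σ i = 1 then .inr i else .inl i))
    (by rintro (i | i) <;> by_cases h : σ i = 1 <;> simp [h])

theorem signSwap_symm_inl {κ : Type*} (σ : κ → ℤˣ) (i : κ) :
    (signSwap σ).symm (.inl i) = if σ i = 1 then .inl i else .inr i := rfl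

theorem signSwap_symm_inr {κ : Type*} (σ : κ → ℤˣ) (i : κ) :
    (signSwap σ).symm (.inr i) = if σ i = 1 then .inr i else .inl i := rfl

variable [IsProbabilityMeasure D]

/-- A sign `-1` at `i` amounts to exchanging the sample point `i` with its ghost, and the product
measure is invariant under such exchanges. -/
theorem integral_signed_ciSup_eq {n : ℕ} (σ : Fin n → ℤˣ) :
    ∫ w : Fin n ⊕ Fin n → Z, ⨆ j, ∑ i, ((σ i : ℤ) : ℝ) * (g j (w (.inr i)) - g j (w (.inl i)))
        ∂(Measure.pi fun _ => D) =
      ∫ w : Fin n ⊕ Fin n → Z, ⨆ j, ∑ i, (g j (w (.inr i)) - g j (w (.inl i)))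
        ∂(Measure.pi fun _ => D) := by
  have hmp := measurePreserving_piCongrLeft (fun _ : Fin n ⊕ Fin n => D) (signSwap σ)
  rw [← hmp.integral_comp']
  refine integral_congr_ae (Filter.Eventually.of_forall fun w => ?_)
  refine congrArg iSup (funext fun j => Finset.sum_congr rfl fun i _ => ?_)
  rcases Int.units_eq_one_or (σ i) with h | h <;>
    simp [piCongrLeft_const_apply, signSwap_symm_inl,
      signSwap_symm_inr, h]

theorem integrable_of_abs_le {Y : Type*} [MeasurableSpace Y] {μ : Measure Y} [IsFiniteMeasure μ]
    {f : Y → ℝ} (hf : AEMeasurable f μ) {B : ℝ} (hB : ∀ y, |f y| ≤ B) : Integrable f μ :=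
  Integrable.of_bound hf.aestronglyMeasurable B (Filter.Eventually.of_forall hB)

theorem abs_sum_le {κ : Type*} [Fintype κ] {f : κ → ℝ} {B : ℝ} (hf : ∀ i, |f i| ≤ B) :
    |∑ i, f i| ≤ Fintype.card κ * B := by
  refine (Finset.abs_sum_le_sum_abs _ _).trans
    ((Finset.sum_le_card_nsmul _ _ B fun i _ => hf i).trans ?_)
  simp

/-- With weights `-σ i` on the sample and `σ i` on the ghost the means cancel, so this is a supremum
of centred weighted sums as in `hm`. -/
theorem aemeasurable_signed_ciSup
    (hm : ∀ (m : ℕ) (a : Fin m → ℝ), AEMeasurable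
      (fun z : Fin m → Z => ⨆ j, ∑ i, a i * (g j (z i) - ∫ x, g j x ∂D)) (Measure.pi fun _ => D))
    {n : ℕ} (σ : Fin n → ℤˣ) :
    AEMeasurable (fun w : Fin n ⊕ Fin n → Z =>
      ⨆ j, ∑ i, ((σ i : ℤ) : ℝ) * (g j (w (.inr i)) - g j (w (.inl i))))
      (Measure.pi fun _ => D) := by
  convert aemeasurable_ciSup_fintype hm (κ := Fin n ⊕ Fin n)
    (Sum.elim (fun i => -((σ i : ℤ) : ℝ)) fun i => ((σ i : ℤ) : ℝ)) using 1
  ext w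
  refine congrArg iSup (funext fun j => ?_)
  rw [Fintype.sum_sum_type, ← Finset.sum_add_distrib]
  refine Finset.sum_congr rfl fun i _ => ?_
  simp only [Sum.elim_inl, Sum.elim_inr]
  ring

theorem abs_integral_sub_le (hC : ∀ j x, |g j x| ≤ C) (j : ι) (x : Z) :
    |∫ x, g j x ∂D - g j x| ≤ 2 * C := by
  have h1 : |∫ x, g j x ∂D| ≤ C := by
    simpa using norm_integral_le_of_norm_le_const (μ := D) (f := g j)
      (Filter.Eventually.of_forall (hC j))
  exact (abs_sub _ _).trans (by linarith [hC j x])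

variable [Nonempty ι]

theorem integrable_signed_ciSup (hC : ∀ j x, |g j x| ≤ C)
    (hm : ∀ (m : ℕ) (a : Fin m → ℝ), AEMeasurable
      (fun z : Fin m → Z => ⨆ j, ∑ i, a i * (g j (z i) - ∫ x, g j x ∂D)) (Measure.pi fun _ => D))
    {n : ℕ} (σ : Fin n → ℤˣ) :
    Integrable (fun w : Fin n ⊕ Fin n → Z =>
      ⨆ j, ∑ i, ((σ i : ℤ) : ℝ) * (g j (w (.inr i)) - g j (w (.inl i))))
      (Measure.pi fun _ => D) :=
  integrable_of_abs_le (aemeasurable_signed_ciSup hm σ) fun _ => abs_ciSup_le fun j =>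
    abs_sum_le fun i => abs_signed_sub_le hC (σ i) j _ _

/-- The ghost sample step: the expected one-sided uniform deviation is at most the expected
supremum of the differences between two independent samples. -/
theorem integral_deviation_le_ghost (hg : ∀ j, Measurable (g j)) (hC : ∀ j x, |g j x| ≤ C)
    (hm : ∀ (m : ℕ) (a : Fin m → ℝ), AEMeasurable
      (fun z : Fin m → Z => ⨆ j, ∑ i, a i * (g j (z i) - ∫ x, g j x ∂D)) (Measure.pi fun _ => D))
    (n : ℕ) :
    ∫ z : Fin n → Z, ⨆ j, ∑ i, (∫ x, g j x ∂D - g j (z i)) ∂(Measure.pi fun _ => D) ≤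
      ∫ w : Fin n ⊕ Fin n → Z, ⨆ j, ∑ i, (g j (w (.inr i)) - g j (w (.inl i)))
        ∂(Measure.pi fun _ => D) := by
  have hmp := measurePreserving_sumPiEquivProdPi_symm (fun _ : Fin n ⊕ Fin n => D)
  have hint := integrable_signed_ciSup hC hm (n := n) 1
  simp only [Pi.one_apply, Units.val_one, Int.cast_one, one_mul] at hint
  have hint' := (hmp.integrable_comp_emb (MeasurableEquiv.measurableEmbedding _)).2 hint
  rw [← hmp.integral_comp']
  refine le_of_le_of_eq ?_ (integral_prod _ hint').symm
  refine integral_mono_ae (integrable_of_abs_le (aemeasurable_deviation hm n) fun z =>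
    abs_ciSup_le fun j => abs_sum_le fun i => abs_integral_sub_le hC j (z i))
    hint'.integral_prod_left ?_
  filter_upwards [hint'.prod_right_ae] with z hz
  -- For a fixed sample `z`, the deviation of each `j` is an average over the ghost sample, hence at
  -- most the average of the supremum.
  refine ciSup_le fun j => ?_
  have hgi : ∀ i : Fin n, Integrable (fun z' : Fin n → Z => g j (z' i)) (Measure.pi fun _ => D) :=
    fun i => integrable_of_abs_le ((hg j).comp (measurable_pi_apply i)).aemeasurable fun _ => hC j _
  have hev : ∀ i : Fin n, ∫ z' : Fin n → Z, g j (z' i) ∂(Measure.pi fun _ => D) =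
      ∫ x, g j x ∂D := fun i =>
    integral_comp_eval (μ := fun _ : Fin n => D) (hg j).aestronglyMeasurable
  calc ∑ i, (∫ x, g j x ∂D - g j (z i))
      = ∫ z' : Fin n → Z, ∑ i, (g j (z' i) - g j (z i)) ∂(Measure.pi fun _ => D) := by
        rw [integral_finsetSum _ fun i _ => (hgi i).sub' (integrable_const _)]
        refine Finset.sum_congr rfl fun i _ => ?_
        rw [integral_sub (hgi i) (integrable_const _), hev i]
        simp
    _ ≤ _ := by
        refine integral_mono (integrable_finsetSum _ fun i _ => (hgi i).sub (integrable_const _))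
          hz fun z' => ?_
        have hb : BddFun fun j => ∑ i, (g j (z' i) - g j (z i)) :=
          ⟨_, fun j => abs_sum_le fun i => by simpa using abs_signed_sub_le hC 1 j (z' i) (z i)⟩
        exact hb.le_ciSup j

/-- Symmetrization: the expected one-sided uniform deviation is at most the expected average over
signs of the suprema of the signed differences between two independent samples. -/
theorem integral_deviation_le_signed (hg : ∀ j, Measurable (g j)) (hC : ∀ j x, |g j x| ≤ C)
    (hm : ∀ (m : ℕ) (a : Fin m → ℝ), AEMeasurable
      (fun z : Fin m → Z => ⨆ j, ∑ i, a i * (g j (z i) - ∫ x, g j x ∂D)) (Measure.pi fun _ => D))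
    (n : ℕ) :
    ∫ z : Fin n → Z, ⨆ j, ∑ i, (∫ x, g j x ∂D - g j (z i)) ∂(Measure.pi fun _ => D) ≤
      ∫ w : Fin n ⊕ Fin n → Z, (2 ^ n)⁻¹ * ∑ σ : Fin n → ℤˣ,
        ⨆ j, ∑ i, ((σ i : ℤ) : ℝ) * (g j (w (.inr i)) - g j (w (.inl i)))
        ∂(Measure.pi fun _ => D) := by
  refine (integral_deviation_le_ghost hg hC hm n).trans (le_of_eq ?_)
  rw [integral_const_mul, integral_finsetSum _ fun σ _ => integrable_signed_ciSup hC hm σ,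
    Finset.sum_congr rfl fun σ _ => integral_signed_ciSup_eq (g := g) (D := D) σ,
    Finset.sum_const, Finset.card_univ, Fintype.card_fun, Fintype.card_units_int, Fintype.card_fin,
    nsmul_eq_mul, Nat.cast_pow, Nat.cast_ofNat, inv_mul_cancel_left₀ (by positivity)]

/-- Symmetrization: the expected one-sided uniform deviation of a bounded class is at most twice
any integrated bound on its empirical Rademacher averages. -/
theorem ofReal_integral_deviation_le (hg : ∀ j, Measurable (g j)) (hC : ∀ j x, |g j x| ≤ C)
    (hm : ∀ (m : ℕ) (a : Fin m → ℝ), AEMeasurable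
      (fun z : Fin m → Z => ⨆ j, ∑ i, a i * (g j (z i) - ∫ x, g j x ∂D)) (Measure.pi fun _ => D))
    {n : ℕ} {W : (Fin n → Z) → ENNReal} (hW : AEMeasurable W (Measure.pi fun _ => D))
    (hle : ∀ z, ENNReal.ofReal ((2 ^ n)⁻¹ * ∑ σ : Fin n → ℤˣ,
      ⨆ j, ∑ i, ((σ i : ℤ) : ℝ) * g j (z i)) ≤ W z) :
    ENNReal.ofReal (∫ z : Fin n → Z, ⨆ j, ∑ i, (∫ x, g j x ∂D - g j (z i))
      ∂(Measure.pi fun _ => D)) ≤ 2 * ∫⁻ z, W z ∂(Measure.pi fun _ => D) := by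
  have hmp := measurePreserving_sumPiEquivProdPi (fun _ : Fin n ⊕ Fin n => D)
  have hmr : MeasurePreserving (fun (w : Fin n ⊕ Fin n → Z) i => w (.inr i))
      (Measure.pi fun _ => D) (Measure.pi fun _ => D) := measurePreserving_snd.comp hmp
  have hml : MeasurePreserving (fun (w : Fin n ⊕ Fin n → Z) i => w (.inl i))
      (Measure.pi fun _ => D) (Measure.pi fun _ => D) := measurePreserving_fst.comp hmp
  have hWr : AEMeasurable (fun w : Fin n ⊕ Fin n → Z => W fun i => w (.inr i))
      (Measure.pi fun _ => D) := hW.comp_quasiMeasurePreserving hmr.quasiMeasurePreserving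
  refine (ENNReal.ofReal_le_ofReal (integral_deviation_le_signed hg hC hm n)).trans ?_
  refine (ofReal_integral_le_lintegral ((integrable_finsetSum _ fun σ _ =>
    integrable_signed_ciSup hC hm σ).const_mul _)).trans ?_
  refine (lintegral_mono (g := fun w => W (fun i => w (.inr i)) + W (fun i => w (.inl i)))
    fun w => ?_).trans (le_of_eq ?_)
  · exact (ENNReal.ofReal_le_ofReal (signed_average_le hC w)).trans
      (ENNReal.ofReal_add_le.trans (add_le_add (hle _) (hle _)))
  · rw [lintegral_add_left' hWr, lintegral_comp_of_aemeasurable hmr hW,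
      lintegral_comp_of_aemeasurable hml hW, two_mul]

end Symmetrization

/-! ### Concentration of the deviations -/

theorem sum_sub_sum_update {Z κ : Type*} [Fintype κ] [DecidableEq κ] (F : Z → ℝ) (z : κ → Z) (i : κ)
    (x : Z) : ∑ k, F (z k) - ∑ k, F (Function.update z i x k) = F (z i) - F x := by
  rw [← Finset.sum_sub_distrib, Finset.sum_eq_single i]
  · simp
  · intro k _ hk
    simp [Function.update_of_ne hk]
  · simp

/-- Concentration of the sum of the one-sided uniform deviation of a class with values in `[0, C]`
and of the deviation of one fixed member of the class. -/
theorem measure_deviation_ge_le {Z ι : Type*} [MeasurableSpace Z] {D : Measure Z}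
    [IsProbabilityMeasure D] {g : ι → Z → ℝ} {C : ℝ} (hC : 0 < C) (hg : ∀ j, Measurable (g j))
    (hgC : ∀ j x, 0 ≤ g j x ∧ g j x ≤ C)
    (hm : ∀ (m : ℕ) (a : Fin m → ℝ), AEMeasurable
      (fun z : Fin m → Z => ⨆ j, ∑ i, a i * (g j (z i) - ∫ x, g j x ∂D)) (Measure.pi fun _ => D))
    {n : ℕ} (hn : 0 < n) (k : ι) {ε : ℝ} (hε : 0 ≤ ε) :
    (Measure.pi fun _ => D).real {z : Fin n → Z |
      ∫ z : Fin n → Z, ⨆ j, ∑ i, (∫ x, g j x ∂D - g j (z i)) ∂(Measure.pi fun _ => D) + ε ≤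
        (⨆ j, ∑ i, (∫ x, g j x ∂D - g j (z i))) + ∑ i, (g k (z i) - ∫ x, g k x ∂D)} ≤
      Real.exp (-(ε ^ 2 / (2 * n * C ^ 2))) := by
  have : Nonempty ι := ⟨k⟩
  have habs : ∀ j x, |g j x| ≤ C := fun j x => abs_le.2 ⟨by linarith [(hgC j x).1], (hgC j x).2⟩
  have hTm := aemeasurable_deviation hm n
  have hTB : ∀ z : Fin n → Z, ∀ j, |∑ i, (∫ x, g j x ∂D - g j (z i))| ≤ n * (2 * C) := fun z j => by
    simpa using abs_sum_le fun i => abs_integral_sub_le (D := D) habs j (z i)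
  have hkm : ∀ i : Fin n, Integrable (fun z : Fin n → Z => g k (z i)) (Measure.pi fun _ => D) :=
    fun i => integrable_of_abs_le ((hg k).comp (measurable_pi_apply i)).aemeasurable fun _ => habs k _
  have hki : Integrable (fun z : Fin n → Z => ∑ i, (g k (z i) - ∫ x, g k x ∂D))
      (Measure.pi fun _ => D) := integrable_finsetSum _ fun i _ => (hkm i).sub' (integrable_const _)
  have hk0 : ∫ z : Fin n → Z, ∑ i, (g k (z i) - ∫ x, g k x ∂D) ∂(Measure.pi fun _ => D) = 0 := by
    rw [integral_finsetSum _ fun i _ => (hkm i).sub' (integrable_const _)]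
    refine Finset.sum_eq_zero fun i _ => ?_
    rw [integral_sub (hkm i) (integrable_const _),
      integral_comp_eval (μ := fun _ : Fin n => D) (hg k).aestronglyMeasurable]
    simp
  have hTi : Integrable (fun z : Fin n → Z => ⨆ j, ∑ i, (∫ x, g j x ∂D - g j (z i)))
      (Measure.pi fun _ => D) := integrable_of_abs_le hTm fun z => abs_ciSup_le (hTB z)
  have hmean := integral_add hTi hki
  rw [hk0, add_zero] at hmean
  -- One `C` of the difference `2 * C` comes from the supremum, the other from the fixed member `k`.
  have h := measure_ge_le_of_boundedDiff D (c := 2 * C) (B := n * (2 * C) + n * (2 * C))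
    (by positivity) hn
    (f := fun z => (⨆ j, ∑ i, (∫ x, g j x ∂D - g j (z i))) + ∑ i, (g k (z i) - ∫ x, g k x ∂D))
    (hTm.add hki.aemeasurable) ?_ ?_ hε
  · rw [hmean] at h
    refine h.trans (Real.exp_le_exp.2 (neg_le_neg (le_of_eq ?_)))
    have : (n : ℝ) ≠ 0 := by positivity
    field_simp
  · intro z
    refine (abs_add_le _ _).trans (add_le_add (abs_ciSup_le (hTB z)) ?_)
    have := hTB z k
    rwa [← abs_neg, ← Finset.sum_neg_distrib, Finset.sum_congr rfl fun i _ => neg_sub _ _] at this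
  · intro z i x
    have h1 : (⨆ j, ∑ i, (∫ x, g j x ∂D - g j (z i))) ≤
        (⨆ j, ∑ k, (∫ x, g j x ∂D - g j (Function.update z i x k))) + C := by
      refine ciSup_le fun j => ?_
      have hb : BddFun fun j => ∑ k, (∫ x, g j x ∂D - g j (Function.update z i x k)) :=
        ⟨_, hTB (Function.update z i x)⟩
      have h2 := hb.le_ciSup j
      have h3 := sum_sub_sum_update (fun y => ∫ x, g j x ∂D - g j y) z i x
      linarith [(hgC j (z i)).1, (hgC j x).2]
    have h3 := sum_sub_sum_update (fun y => g k y - ∫ x, g k x ∂D) z i x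
    linarith [(hgC k (z i)).2, (hgC k x).1]

/-! ### Empirical Rademacher complexity, finite and infinite -/

section EmpiricalRademacher

variable {Z : Type*}

theorem coe_ciSup {ι : Type*} [Nonempty ι] {f : ι → ℝ} (hf : BddFun f) :
    ((⨆ j, f j : ℝ) : EReal) = ⨆ j, (f j : EReal) :=
  Monotone.map_ciSup_of_continuousAt continuous_coe_real_ereal.continuousAt
    (fun _ _ h => EReal.coe_le_coe_iff.2 h) hf.bddAbove

theorem coe_sum_ereal {κ : Type*} (s : Finset κ) (f : κ → ℝ) :
    ((∑ i ∈ s, f i : ℝ) : EReal) = ∑ i ∈ s, (f i : EReal) := by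
  classical
  induction s using Finset.induction_on with
  | empty => simp
  | insert i s hi ih => rw [Finset.sum_insert hi, Finset.sum_insert hi, EReal.coe_add, ih]

theorem sum_ne_bot {κ : Type*} (s : Finset κ) {f : κ → EReal} (hf : ∀ i, f i ≠ ⊥) :
    ∑ i ∈ s, f i ≠ ⊥ := by
  classical
  induction s using Finset.induction_on with
  | empty => simp
  | insert i s hi ih =>
    rw [Finset.sum_insert hi]
    exact EReal.add_ne_bot_iff.2 ⟨hf i, ih⟩

theorem empRademacher_eq_coe {n : ℕ} {F : Set (Z → ℝ)} (hF : F.Nonempty) {z : Fin n → Z}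
    (hb : ∀ i, BddFun fun f : F => f.1 (z i)) :
    empRademacher F z = (((2 : ℝ) ^ n)⁻¹ * ((n : ℝ)⁻¹ *
      ∑ σ : Fin n → ℤˣ, ⨆ f : F, ∑ i, ((σ i : ℤ) : ℝ) * f.1 (z i)) : ℝ) := by
  have : Nonempty F := hF.to_subtype
  rw [empRademacher, EReal.coe_mul, Finset.mul_sum, coe_sum_ereal]
  congr 1
  refine Finset.sum_congr rfl fun σ _ => ?_
  rw [Real.mul_iSup_of_nonneg (by positivity), coe_ciSup, iSup_subtype']
  exact (BddFun.sum fun i _ => (hb i).const_mul _).const_mul _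

/-- Choosing `σ i` as the sign of `f (z i)` turns the signed sum into `∑ |f (z i)|`. If all suprema
were finite, they would therefore bound the class at each sample point. No supremum is `⊥`, so one
value `⊤` makes the whole sum `⊤`. -/
theorem empRademacher_eq_top {n : ℕ} (hn : 0 < n) {F : Set (Z → ℝ)} (hF : F.Nonempty)
    {z : Fin n → Z} (hb : ¬ ∀ i, BddFun fun f : F => f.1 (z i)) : empRademacher F z = ⊤ := by
  set s : (Fin n → ℤˣ) → EReal := fun σ =>
    ⨆ f ∈ F, (((n : ℝ)⁻¹ * ∑ i, ((σ i : ℤ) : ℝ) * f (z i) : ℝ) : EReal) with hs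
  have hle : ∀ σ, ∀ f ∈ F, (((n : ℝ)⁻¹ * ∑ i, ((σ i : ℤ) : ℝ) * f (z i) : ℝ) : EReal) ≤ s σ :=
    fun σ f hf => le_iSup₂_of_le f hf le_rfl
  have hbot : ∀ σ, s σ ≠ ⊥ := fun σ hσ => by
    obtain ⟨f, hf⟩ := hF
    exact EReal.coe_ne_bot _ (le_bot_iff.1 (hσ ▸ hle σ f hf))
  obtain ⟨σ₀, hσ₀⟩ : ∃ σ, s σ = ⊤ := by
    by_contra! htop
    refine hb fun i => ⟨n * ∑ σ, |(s σ).toReal|, fun f => ?_⟩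
    have hn' : (0 : ℝ) < n := by exact_mod_cast hn
    set σ : Fin n → ℤˣ := fun i => if 0 ≤ f.1 (z i) then 1 else -1 with hσ
    have habs : ∀ i, ((σ i : ℤ) : ℝ) * f.1 (z i) = |f.1 (z i)| := fun i => by
      by_cases h : 0 ≤ f.1 (z i)
      · simp [hσ, h, abs_of_nonneg h]
      · simp [hσ, h, abs_of_neg (not_le.1 h)]
    have h1 := hle σ f.1 f.2
    rw [← EReal.coe_toReal (htop σ) (hbot σ), EReal.coe_le_coe_iff] at h1
    simp only [habs] at h1
    rw [inv_mul_le_iff₀ hn'] at h1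
    calc |f.1 (z i)| ≤ ∑ i, |f.1 (z i)| :=
          Finset.single_le_sum (f := fun i => |f.1 (z i)|) (fun _ _ => abs_nonneg _)
            (Finset.mem_univ i)
      _ ≤ n * (s σ).toReal := h1
      _ ≤ n * ∑ σ, |(s σ).toReal| := by
          gcongr
          exact (le_abs_self _).trans (Finset.single_le_sum (f := fun σ => |(s σ).toReal|)
            (fun _ _ => abs_nonneg _) (Finset.mem_univ σ))
  have hsum : ∑ σ, s σ = ⊤ := by
    rw [← Finset.add_sum_erase _ _ (Finset.mem_univ σ₀), hσ₀]
    exact EReal.top_add_of_ne_bot (sum_ne_bot _ hbot)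
  change (((2 : ℝ) ^ n)⁻¹ : ℝ) * ∑ σ, s σ = ⊤
  rw [hsum, EReal.coe_mul_top_of_pos (by positivity)]

theorem aemeasurable_empRademacher [MeasurableSpace Z] {P : Measure Z} {F : Set (Z → ℝ)}
    (hF : IsMeasurableClass P F) (n : ℕ) :
    AEMeasurable (fun z : Fin n → Z => empRademacher F z) (Measure.pi fun _ => P) := by
  unfold empRademacher
  refine AEMeasurable.const_mul (Finset.aemeasurable_fun_sum _ fun σ _ => ?_) _
  have := hF n fun i => (n : ℝ)⁻¹ * ((σ i : ℤ) : ℝ)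
  simpa only [Finset.mul_sum, mul_assoc] using this

/-- The contraction inequality for a loss class that is Lipschitz in the values of two classes,
in terms of their empirical Rademacher complexities. -/
theorem ofReal_average_le_empRademacher {n : ℕ} (hn : 0 < n) {H R : Set (Z → ℝ)}
    (hH : H.Nonempty) (hR : R.Nonempty) {z : Fin n → Z} (hHb : ∀ i, BddFun fun h : H => h.1 (z i))
    {a b α : ℝ} (ha : 0 ≤ a) (hb : 0 ≤ b) (hα : 0 < α) (hab : a + b ≤ α) {w : H × R → Fin n → ℝ}
    (hw : ∀ i, BddFun fun j => w j i)
    (hL : ∀ i j k, |w j i - w k i| ≤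
      a * |j.1.1 (z i) - k.1.1 (z i)| + b * |j.2.1 (z i) - k.2.1 (z i)|) :
    ENNReal.ofReal ((2 ^ n)⁻¹ * ∑ σ : Fin n → ℤˣ, ⨆ j, ∑ i, ((σ i : ℤ) : ℝ) * w j i) ≤
      ENNReal.ofReal (α * n) * ((empRademacher H z).toENNReal + (empRademacher R z).toENNReal) := by
  have : Nonempty H := hH.to_subtype
  have : Nonempty R := hR.to_subtype
  have hn' : (0 : ℝ) < n := by exact_mod_cast hn
  by_cases hRb : ∀ i, BddFun fun r : R => r.1 (z i)
  · rw [empRademacher_eq_coe hH hHb, empRademacher_eq_coe hR hRb,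
      EReal.toENNReal_of_ne_top (EReal.coe_ne_top _), EReal.toENNReal_of_ne_top (EReal.coe_ne_top _),
      EReal.toReal_coe, EReal.toReal_coe]
    refine le_trans ?_ (mul_le_mul_right ENNReal.ofReal_add_le _)
    rw [← ENNReal.ofReal_mul (by positivity)]
    refine ENNReal.ofReal_le_ofReal ?_
    have h := contraction_prod ha hb hab (u := fun (h : H) i => h.1 (z i))
      (v := fun (r : R) i => r.1 (z i)) hHb hRb hw hL
    refine (mul_le_mul_of_nonneg_left h (by positivity)).trans (le_of_eq ?_)
    field_simp
  · rw [empRademacher_eq_top hn hR hRb]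
    simp only [EReal.toENNReal_top, add_top]
    rw [ENNReal.mul_top (by simpa using mul_pos hα hn')]
    exact le_top

end EmpiricalRademacher

/-! ### The clipped loss: range, Lipschitz constants, measurability -/

section ClippedLoss

variable {X : Type*}

/-- The surrogate loss with the response clipped to `[-M, M]`. -/
def clippedLoss (M : ℝ) (ℓ : ℝ → ℤˣ → ℝ) (c h r : X → ℝ) (z : X × ℝ) : ℝ :=
  surrogate ℓ c h r (z.1, max (-M) (min z.2 M))

theorem abs_clip_le {M : ℝ} (hM : 0 < M) (y : ℝ) : |max (-M) (min y M)| ≤ M :=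
  abs_le.2 ⟨le_max_left _ _, max_le (by linarith) (min_le_right _ _)⟩

theorem clippedLoss_eq {M : ℝ} {ℓ : ℝ → ℤˣ → ℝ} {c h r : X → ℝ} {z : X × ℝ} (hz : |z.2| ≤ M) :
    clippedLoss M ℓ c h r z = surrogate ℓ c h r z := by
  obtain ⟨h1, h2⟩ := abs_le.1 hz
  rw [clippedLoss, min_eq_left h2, max_eq_right h1]

variable {M₁ M₂ : ℝ} {ℓ : ℝ → ℤˣ → ℝ} {c : X → ℝ}

theorem clippedLoss_mem (hM₂ : 0 < M₂) (hℓ : ∀ t z, 0 ≤ ℓ t z ∧ ℓ t z ≤ M₁)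
    (hcb : ∀ x, 0 ≤ c x ∧ c x ≤ M₂) {h : X → ℝ} (hh : ∀ x, |h x| ≤ M₂) (r : X → ℝ) (z : X × ℝ) :
    0 ≤ clippedLoss M₂ ℓ c h r z ∧ clippedLoss M₂ ℓ c h r z ≤ (4 * M₂ ^ 2 + M₂) * M₁ := by
  unfold clippedLoss surrogate
  obtain ⟨hA0, hA⟩ := hℓ (r z.1) (-1)
  obtain ⟨hB0, hB⟩ := hℓ (r z.1) 1
  obtain ⟨hc0, hc⟩ := hcb z.1
  have hsq : (h z.1 - max (-M₂) (min z.2 M₂)) ^ 2 ≤ 4 * M₂ ^ 2 := by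
    have h1 : |h z.1 - max (-M₂) (min z.2 M₂)| ≤ 2 * M₂ :=
      (abs_sub _ _).trans (by linarith [hh z.1, abs_clip_le hM₂ z.2])
    calc _ = |h z.1 - max (-M₂) (min z.2 M₂)| ^ 2 := (sq_abs _).symm
      _ ≤ (2 * M₂) ^ 2 := by gcongr
      _ = _ := by ring
  refine ⟨by positivity, ?_⟩
  rw [add_mul]
  exact add_le_add (mul_le_mul hsq hA hA0 (by positivity)) (mul_le_mul hc hB hB0 hM₂.le)

/-- Change `h` first, then `r`. The difference of squares factors with `|h + h' - 2y| ≤ 4 M₂`, and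
the loss in front of it is at most `M₁`; after that `(h' - y)² ≤ 4 M₂²` and `c ≤ M₂` multiply the
`ρ`-Lipschitz increments of `ℓ`. -/
theorem abs_clippedLoss_sub_le {ρ : NNReal} (hM₂ : 0 < M₂)
    (hℓ : ∀ t z, 0 ≤ ℓ t z ∧ ℓ t z ≤ M₁) (hℓρ : ∀ z, LipschitzWith ρ (fun t => ℓ t z))
    (hcb : ∀ x, 0 ≤ c x ∧ c x ≤ M₂) {h h' : X → ℝ} (hh : ∀ x, |h x| ≤ M₂) (hh' : ∀ x, |h' x| ≤ M₂)
    (r r' : X → ℝ) (z : X × ℝ) :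
    |clippedLoss M₂ ℓ c h r z - clippedLoss M₂ ℓ c h' r' z| ≤
      4 * M₁ * M₂ * |h z.1 - h' z.1| + (4 * M₂ ^ 2 * ρ + M₂ * ρ) * |r z.1 - r' z.1| := by
  simp only [clippedLoss, surrogate]
  set y := max (-M₂) (min z.2 M₂)
  have hy : |y| ≤ M₂ := abs_clip_le hM₂ z.2
  have hlip : ∀ s, |ℓ (r z.1) s - ℓ (r' z.1) s| ≤ ρ * |r z.1 - r' z.1| := fun s => by
    simpa [Real.dist_eq] using (hℓρ s).dist_le_mul (r z.1) (r' z.1)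
  obtain ⟨hA0, hA⟩ := hℓ (r z.1) (-1)
  obtain ⟨hc0, hc⟩ := hcb z.1
  have hM₁ : 0 ≤ M₁ := hA0.trans hA
  have h1 : |h z.1 + h' z.1 - 2 * y| ≤ 4 * M₂ := by
    have := abs_le.1 (hh z.1)
    have := abs_le.1 (hh' z.1)
    have := abs_le.1 hy
    exact abs_le.2 ⟨by linarith, by linarith⟩
  have h2 : |h' z.1 - y| ≤ 2 * M₂ := (abs_sub _ _).trans (by linarith [hh' z.1])
  have e : (h z.1 - y) ^ 2 * ℓ (r z.1) (-1) + c z.1 * ℓ (r z.1) 1 -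
      ((h' z.1 - y) ^ 2 * ℓ (r' z.1) (-1) + c z.1 * ℓ (r' z.1) 1) =
      (h z.1 - h' z.1) * (h z.1 + h' z.1 - 2 * y) * ℓ (r z.1) (-1) +
      (h' z.1 - y) ^ 2 * (ℓ (r z.1) (-1) - ℓ (r' z.1) (-1)) +
      c z.1 * (ℓ (r z.1) 1 - ℓ (r' z.1) 1) := by ring
  rw [e]
  refine (abs_add_three _ _ _).trans ?_
  simp only [abs_mul, abs_pow, abs_of_nonneg hA0, abs_of_nonneg hc0]
  calc _ ≤ |h z.1 - h' z.1| * (4 * M₂) * M₁ + (2 * M₂) ^ 2 * (ρ * |r z.1 - r' z.1|) +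
        M₂ * (ρ * |r z.1 - r' z.1|) := by
        gcongr
        · exact hlip _
        · exact hlip _
    _ = _ := by ring

theorem measurable_clippedLoss [MeasurableSpace X] {ρ : NNReal} {M : ℝ}
    (hℓρ : ∀ z, LipschitzWith ρ (fun t => ℓ t z)) (hc : Measurable c) {h r : X → ℝ}
    (hh : Measurable h) (hr : Measurable r) : Measurable (clippedLoss M ℓ c h r) := by
  have hm : ∀ s, Measurable fun t => ℓ t s := fun s => (hℓρ s).continuous.measurable
  have h1 : Measurable fun z : X × ℝ => ℓ (r z.1) (-1) := (hm (-1)).comp (hr.comp measurable_fst)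
  have h2 : Measurable fun z : X × ℝ => ℓ (r z.1) 1 := (hm 1).comp (hr.comp measurable_fst)
  unfold clippedLoss surrogate
  fun_prop

theorem integral_clippedLoss [MeasurableSpace X] {D : Measure (X × ℝ)} {M : ℝ}
    (hyb : ∀ᵐ z ∂D, |z.2| ≤ M) (h r : X → ℝ) :
    ∫ z, clippedLoss M ℓ c h r z ∂D = risk D ℓ c h r :=
  integral_congr_ae (hyb.mono fun _ hz => clippedLoss_eq hz)

theorem ae_pi_all {Z : Type*} [MeasurableSpace Z] {D : Measure Z} [IsProbabilityMeasure D]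
    {p : Z → Prop} (hp : ∀ᵐ z ∂D, p z) (n : ℕ) :
    ∀ᵐ z : Fin n → Z ∂(Measure.pi fun _ => D), ∀ i, p (z i) :=
  ae_all_iff.2 fun i =>
    (measurePreserving_eval (fun _ : Fin n => D) i).quasiMeasurePreserving.ae hp

/-- The suprema of the centred clipped losses inherit measurability from the centred losses. -/
theorem aemeasurable_ciSup_clippedLoss [MeasurableSpace X] {D : Measure (X × ℝ)}
    [IsProbabilityMeasure D] {H R : Set (X → ℝ)} [Nonempty H] [Nonempty R]
    (hψm : IsMeasurableClass D (centredLosses D ℓ c H R)) (hM₂ : 0 < M₂)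
    (hℓ : ∀ t z, 0 ≤ ℓ t z ∧ ℓ t z ≤ M₁) (hHb : ∀ h ∈ H, ∀ x, |h x| ≤ M₂)
    (hcb : ∀ x, 0 ≤ c x ∧ c x ≤ M₂) (hyb : ∀ᵐ z ∂D, |z.2| ≤ M₂) (m : ℕ) (a : Fin m → ℝ) :
    AEMeasurable (fun z : Fin m → X × ℝ => ⨆ j : H × R, ∑ i, a i *
      (clippedLoss M₂ ℓ c j.1.1 j.2.1 (z i) - ∫ x, clippedLoss M₂ ℓ c j.1.1 j.2.1 x ∂D))
      (Measure.pi fun _ => D) := by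
  -- Where all responses are at most `M₂` in absolute value, clipping does nothing; the family is
  -- bounded there, so the `EReal` supremum is finite and `toReal` recovers the real one.
  refine (hψm m a).ereal_toReal.congr ?_
  filter_upwards [ae_pi_all hyb m] with z hz
  have habs : ∀ (j : H × R) x, |clippedLoss M₂ ℓ c j.1.1 j.2.1 x| ≤ (4 * M₂ ^ 2 + M₂) * M₁ :=
    fun j x => by
      obtain ⟨h0, h1⟩ := clippedLoss_mem hM₂ hℓ hcb (hHb j.1.1 j.1.2) j.2.1 x
      rwa [abs_of_nonneg h0]
  have hb : BddFun fun j : H × R => ∑ i, a i *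
      (clippedLoss M₂ ℓ c j.1.1 j.2.1 (z i) - ∫ x, clippedLoss M₂ ℓ c j.1.1 j.2.1 x ∂D) := by
    refine BddFun.sum fun i _ => BddFun.const_mul ⟨2 * ((4 * M₂ ^ 2 + M₂) * M₁), fun j => ?_⟩ _
    rw [abs_sub_comm]
    exact abs_integral_sub_le (g := fun (j : H × R) => clippedLoss M₂ ℓ c j.1.1 j.2.1) habs j (z i)
  rw [← EReal.toReal_coe (⨆ j : H × R, _), coe_ciSup hb]
  congr 1
  simp only [integral_clippedLoss hyb, clippedLoss_eq (hz _)]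
  apply le_antisymm
  · refine iSup₂_le fun f hf => ?_
    obtain ⟨h, hh, r, hr, rfl⟩ := hf
    exact le_iSup_of_le (⟨⟨h, hh⟩, ⟨r, hr⟩⟩ : H × R) le_rfl
  · exact iSup_le fun j => le_iSup₂_of_le
      (fun z => surrogate ℓ c j.1.1 j.2.1 z - risk D ℓ c j.1.1 j.2.1)
      ⟨j.1.1, j.1.2, j.2.1, j.2.2, rfl⟩ le_rfl

end ClippedLoss

/-! ### From uniform deviation to excess risk -/

/-- Excess risk of empirical minimizers relative to a comparison pair `(h₀, r₀)`, in terms of the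
uniform deviation of the clipped losses. -/
theorem risk_sub_risk_le_of_isERM {X : Type*} [MeasurableSpace X] {D : Measure (X × ℝ)}
    [IsProbabilityMeasure D] {ℓ : ℝ → ℤˣ → ℝ} {c : X → ℝ} {H R : Set (X → ℝ)} {M C : ℝ}
    (hC : ∀ (j : H × R) x, |clippedLoss M ℓ c j.1.1 j.2.1 x| ≤ C) (hyb : ∀ᵐ z ∂D, |z.2| ≤ M)
    {n : ℕ} (hn : 0 < n) {z : Fin n → X × ℝ} (hz : ∀ i, |(z i).2| ≤ M) {h r : X → ℝ}
    (herm : IsERM z ℓ c H R h r) (k : H × R) :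
    n * (risk D ℓ c h r - risk D ℓ c k.1.1 k.2.1) ≤
      (⨆ j : H × R, ∑ i, (∫ x, clippedLoss M ℓ c j.1.1 j.2.1 x ∂D -
        clippedLoss M ℓ c j.1.1 j.2.1 (z i))) +
      ∑ i, (clippedLoss M ℓ c k.1.1 k.2.1 (z i) - ∫ x, clippedLoss M ℓ c k.1.1 k.2.1 x ∂D) := by
  obtain ⟨hh, hr, hmin⟩ := herm
  have hb : BddFun fun j : H × R => ∑ i, (∫ x, clippedLoss M ℓ c j.1.1 j.2.1 x ∂D -
      clippedLoss M ℓ c j.1.1 j.2.1 (z i)) :=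
    BddFun.sum fun i _ => ⟨2 * C, fun j =>
      abs_integral_sub_le (g := fun (j : H × R) => clippedLoss M ℓ c j.1.1 j.2.1) hC j (z i)⟩
  have h1 := hb.le_ciSup (⟨⟨h, hh⟩, ⟨r, hr⟩⟩ : H × R)
  have h2 := hmin k.1.1 k.1.2 k.2.1 k.2.2
  have hn' : (0 : ℝ) < n := by exact_mod_cast hn
  rw [empRisk, empRisk, mul_le_mul_iff_right₀ (inv_pos.2 hn')] at h2
  simp only [integral_clippedLoss hyb, clippedLoss_eq (hz _), Finset.sum_sub_distrib,
    Finset.sum_const, Finset.card_univ, Fintype.card_fin, nsmul_eq_mul] at h1 h2 ⊢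
  linarith

/-- The expected uniform deviation of the clipped losses in terms of the Rademacher complexities
of the two classes. -/
theorem ofReal_integral_deviation_le_rademacher {X : Type*} [MeasurableSpace X]
    {D : Measure (X × ℝ)} [IsProbabilityMeasure D] {ℓ : ℝ → ℤˣ → ℝ} {c : X → ℝ}
    {H R : Set (X → ℝ)} [Nonempty H] [Nonempty R]
    (hc : Measurable c) (hH : ∀ h ∈ H, Measurable h) (hR : ∀ r ∈ R, Measurable r)
    (hHm : IsMeasurableClass D.fst H) (hRm : IsMeasurableClass D.fst R)
    (hψm : IsMeasurableClass D (centredLosses D ℓ c H R))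
    {M₁ M₂ : ℝ} {ρ : NNReal} (hM₁ : 0 < M₁) (hM₂ : 0 < M₂)
    (hℓ : ∀ t z, 0 ≤ ℓ t z ∧ ℓ t z ≤ M₁) (hℓρ : ∀ z, LipschitzWith ρ (fun t => ℓ t z))
    (hHb : ∀ h ∈ H, ∀ x, |h x| ≤ M₂) (hcb : ∀ x, 0 ≤ c x ∧ c x ≤ M₂)
    (hyb : ∀ᵐ z ∂D, |z.2| ≤ M₂) {n : ℕ} (hn : 0 < n) {α : ℝ}
    (hα : 4 * M₁ * M₂ + (4 * M₂ ^ 2 * ρ + M₂ * ρ) ≤ α) :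
    ENNReal.ofReal (∫ z : Fin n → X × ℝ, ⨆ j : H × R,
      ∑ i, (∫ x, clippedLoss M₂ ℓ c j.1.1 j.2.1 x ∂D - clippedLoss M₂ ℓ c j.1.1 j.2.1 (z i))
        ∂(Measure.pi fun _ => D)) ≤
      2 * (ENNReal.ofReal (α * n) * (rademacher n D.fst H + rademacher n D.fst R)) := by
  have habs : ∀ (j : H × R) x, |clippedLoss M₂ ℓ c j.1.1 j.2.1 x| ≤ (4 * M₂ ^ 2 + M₂) * M₁ :=
    fun j x => by
      obtain ⟨h0, h1⟩ := clippedLoss_mem hM₂ hℓ hcb (hHb j.1.1 j.1.2) j.2.1 x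
      rwa [abs_of_nonneg h0]
  have hfst : MeasurePreserving (Prod.fst : X × ℝ → X) D D.fst := ⟨measurable_fst, rfl⟩
  have hmp : MeasurePreserving (fun (z : Fin n → X × ℝ) i => (z i).1) (Measure.pi fun _ => D)
      (Measure.pi fun _ => D.fst) := measurePreserving_pi _ _ fun _ => hfst
  have hHe := (aemeasurable_empRademacher hHm n).ereal_toENNReal
  have hRe := (aemeasurable_empRademacher hRm n).ereal_toENNReal
  have hadd : AEMeasurable (fun x : Fin n → X =>
      (empRademacher H x).toENNReal + (empRademacher R x).toENNReal)
      (Measure.pi fun _ => D.fst) := hHe.add hRe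
  have hsum := hadd.const_mul (ENNReal.ofReal (α * n))
  have hint : rademacher n D.fst H + rademacher n D.fst R = ∫⁻ x : Fin n → X,
      ((empRademacher H x).toENNReal + (empRademacher R x).toENNReal)
      ∂(Measure.pi fun _ => D.fst) := (lintegral_add_left' hHe _).symm
  rw [hint, ← lintegral_const_mul'' _ hadd, ← lintegral_comp_of_aemeasurable hmp hsum]
  refine ofReal_integral_deviation_le
    (g := fun (j : H × R) => clippedLoss M₂ ℓ c j.1.1 j.2.1)
    (fun j => measurable_clippedLoss hℓρ hc (hH _ j.1.2) (hR _ j.2.2)) habs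
    (aemeasurable_ciSup_clippedLoss hψm hM₂ hℓ hHb hcb hyb)
    (hsum.comp_quasiMeasurePreserving hmp.quasiMeasurePreserving) fun z => ?_
  exact ofReal_average_le_empRademacher hn (Set.nonempty_coe_sort.1 inferInstance)
    (Set.nonempty_coe_sort.1 inferInstance) (fun i => ⟨M₂, fun h => hHb h.1 h.2 _⟩)
    (a := 4 * M₁ * M₂) (b := 4 * M₂ ^ 2 * ρ + M₂ * ρ) (by positivity) (by positivity)
    (lt_of_lt_of_le (by positivity) hα) hα (fun i => ⟨_, fun j => habs j (z i)⟩)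
    fun i j k => abs_clippedLoss_sub_le hM₂ hℓ hℓρ hcb (hHb _ j.1.2) (hHb _ k.1.2) _ _ (z i)

theorem add_le_sqrt_two_mul_sqrt (a b : ℝ) : a + b ≤ √2 * √(b ^ 2 + a ^ 2) := by
  rw [← Real.sqrt_mul zero_le_two]
  exact Real.le_sqrt_of_sq_le (by nlinarith [sq_nonneg (a - b)])

/-- A property that holds for the product measure outside a set of measure at most `δ` holds with
probability at least `1 - δ` for an i.i.d. sample. -/
theorem exists_event_of_iid {Z Ω : Type*} [MeasurableSpace Z] [MeasurableSpace Ω] {D : Measure Z}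
    [IsProbabilityMeasure D] {n : ℕ} {P : Measure Ω} [IsProbabilityMeasure P] {S : Fin n → Ω → Z}
    (hS : ∀ i, Measurable (S i)) (hind : iIndepFun S P) (hlaw : ∀ i, P.map (S i) = D)
    {δ : ℝ} (hδ : 0 ≤ δ) {p : (Fin n → Z) → Prop}
    (hp : (Measure.pi fun _ => D) {z | ¬ p z} ≤ ENNReal.ofReal δ) :
    ∃ E : Set Ω, MeasurableSet E ∧ ENNReal.ofReal (1 - δ) ≤ P E ∧ ∀ ω ∈ E, p fun i => S i ω := by
  have hmap : P.map (fun ω i => S i ω) = Measure.pi fun _ => D := by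
    rw [(iIndepFun_iff_map_fun_eq_pi_map fun i => (hS i).aemeasurable).1 hind]
    simp only [hlaw]
  have hm : Measurable fun ω i => S i ω := measurable_pi_lambda _ hS
  -- The exceptional set need not be measurable; its measurable hull has the same measure, and the
  -- event is the preimage of the complement.
  set B := toMeasurable (Measure.pi fun _ : Fin n => D) {z | ¬ p z}
  have hB : MeasurableSet B := measurableSet_toMeasurable _ _
  refine ⟨(fun ω i => S i ω) ⁻¹' Bᶜ, hm hB.compl, ?_, fun ω hω => ?_⟩
  · rw [← Measure.map_apply hm hB.compl, hmap, prob_compl_eq_one_sub hB, measure_toMeasurable,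
      ENNReal.ofReal_sub _ hδ, ENNReal.ofReal_one]
    exact tsub_le_tsub_left hp 1
  · by_contra h
    exact hω (subset_toMeasurable _ _ h)

end RcR

theorem mainTheorem6 {X Ω : Type*} [MeasurableSpace X] [MeasurableSpace Ω]
    -- the data distribution, the loss, the cost and the hypothesis classes
    (D : Measure (X × ℝ)) [IsProbabilityMeasure D]
    (ℓ : ℝ → ℤˣ → ℝ) (c : X → ℝ) (H R : Set (X → ℝ))
    (hc : Measurable c) (hH : ∀ h ∈ H, Measurable h) (hR : ∀ r ∈ R, Measurable r)
    -- the suprema over the classes are measurable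
    (hHm : RcR.IsMeasurableClass D.fst H) (hRm : RcR.IsMeasurableClass D.fst R)
    (hψm : RcR.IsMeasurableClass D (RcR.centredLosses D ℓ c H R))
    -- boundedness and Lipschitz continuity
    (M₁ M₂ : ℝ) (ρ : NNReal) (hM₁ : 0 < M₁) (hM₂ : 0 < M₂)
    (hℓ : ∀ t z, 0 ≤ ℓ t z ∧ ℓ t z ≤ M₁)
    (hℓρ : ∀ z, LipschitzWith ρ (fun t => ℓ t z))
    (hHb : ∀ h ∈ H, ∀ x, |h x| ≤ M₂)
    (hcb : ∀ x, 0 ≤ c x ∧ c x ≤ M₂)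
    (hyb : ∀ᵐ z ∂D, |z.2| ≤ M₂)
    -- the i.i.d. sample
    (n : ℕ) (hn : 0 < n)
    (P : Measure Ω) [IsProbabilityMeasure P] (Z : Fin n → Ω → X × ℝ)
    (hZ : ∀ i, Measurable (Z i)) (hZind : iIndepFun Z P) (hZlaw : ∀ i, P.map (Z i) = D)
    (δ : ℝ) (hδ : δ ∈ Set.Ioo (0 : ℝ) 1)
    (C₁ L₁ : ℝ) (hC₁ : C₁ = (4 * M₂ ^ 2 + M₂) * M₁)
    (hL₁ : L₁ = √((4 * M₂ ^ 2 * ρ + M₂ * ρ) ^ 2 + 16 * M₁ ^ 2 * M₂ ^ 2)) :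
    ∃ E : Set Ω, MeasurableSet E ∧ ENNReal.ofReal (1 - δ) ≤ P E ∧
      ∀ ω ∈ E, ∀ h r : X → ℝ, RcR.IsERM (fun i => Z i ω) ℓ c H R h r →
        ENNReal.ofReal (RcR.risk D ℓ c h r - RcR.optRisk D ℓ c H R) ≤
          ENNReal.ofReal (2 * √2 * L₁) *
              (RcR.rademacher n D.fst H + RcR.rademacher n D.fst R) +
            ENNReal.ofReal (C₁ * √(2 * Real.log (2 / δ) / n)) := by
  obtain ⟨hδ0, hδ1⟩ := hδ
  -- If a class is empty there is no minimizer, and the claim is vacuous.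
  by_cases hne : H.Nonempty ∧ R.Nonempty
  swap
  · exact ⟨Set.univ, .univ, by simpa using hδ0.le,
      fun ω _ h r herm => (hne ⟨⟨h, herm.1⟩, ⟨r, herm.2.1⟩⟩).elim⟩
  have : Nonempty H := hne.1.to_subtype
  have : Nonempty R := hne.2.to_subtype
  have hn' : (0 : ℝ) < n := by exact_mod_cast hn
  have hC : 0 < C₁ := by rw [hC₁]; positivity
  have hmem : ∀ (j : H × R) x, 0 ≤ RcR.clippedLoss M₂ ℓ c j.1.1 j.2.1 x ∧
      RcR.clippedLoss M₂ ℓ c j.1.1 j.2.1 x ≤ C₁ := fun j x =>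
    hC₁ ▸ RcR.clippedLoss_mem hM₂ hℓ hcb (hHb j.1.1 j.1.2) j.2.1 x
  have habs : ∀ (j : H × R) x, |RcR.clippedLoss M₂ ℓ c j.1.1 j.2.1 x| ≤ C₁ := fun j x => by
    rw [abs_of_nonneg (hmem j x).1]; exact (hmem j x).2
  have hlog : 0 < Real.log (1 / δ) := Real.log_pos (by rw [lt_div_iff₀ hδ0]; linarith)
  -- the comparison pair is optimal up to the slack between `log (1 / δ)` and `log (2 / δ)`
  have hslack : C₁ * √(2 * Real.log (1 / δ) / n) < C₁ * √(2 * Real.log (2 / δ) / n) := by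
    refine mul_lt_mul_of_pos_left (Real.sqrt_lt_sqrt (by positivity) ?_) hC
    have : Real.log (1 / δ) < Real.log (2 / δ) := Real.log_lt_log (by positivity) (by gcongr; norm_num)
    gcongr
  obtain ⟨_, ⟨h₀, hh₀, r₀, hr₀, rfl⟩, hopt⟩ : ∃ t ∈ {t : ℝ | ∃ h ∈ H, ∃ r ∈ R,
      t = RcR.risk D ℓ c h r}, t < RcR.optRisk D ℓ c H R +
        (C₁ * √(2 * Real.log (2 / δ) / n) - C₁ * √(2 * Real.log (1 / δ) / n)) := by
    refine exists_lt_of_csInf_lt ?_ (lt_add_of_pos_right _ (sub_pos.2 hslack))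
    obtain ⟨⟨h, hh⟩, ⟨r, hr⟩⟩ := hne
    exact ⟨_, h, hh, r, hr, rfl⟩
  -- The deviations are unnormalized sums, hence the factor `n` in `ε`; this `ε` makes the tail
  -- bound exactly `δ`.
  have hdev := RcR.measure_deviation_ge_le (D := D)
    (g := fun (j : H × R) => RcR.clippedLoss M₂ ℓ c j.1.1 j.2.1) hC
    (fun j => RcR.measurable_clippedLoss hℓρ hc (hH _ j.1.2) (hR _ j.2.2)) hmem
    (RcR.aemeasurable_ciSup_clippedLoss hψm hM₂ hℓ hHb hcb hyb) hn (⟨⟨h₀, hh₀⟩, ⟨r₀, hr₀⟩⟩ : H × R)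
    (ε := n * (C₁ * √(2 * Real.log (1 / δ) / n))) (by positivity)
  have hrad := RcR.ofReal_integral_deviation_le_rademacher hc hH hR hHm hRm hψm hM₁ hM₂ hℓ hℓρ hHb
    hcb hyb hn (α := √2 * L₁) (by
      refine (RcR.add_le_sqrt_two_mul_sqrt _ _).trans (le_of_eq ?_)
      rw [hL₁]; ring_nf)
  have hexp : Real.exp (-((n * (C₁ * √(2 * Real.log (1 / δ) / n))) ^ 2 / (2 * n * C₁ ^ 2))) = δ := by
    rw [mul_pow, mul_pow, Real.sq_sqrt (by positivity),
      show (n : ℝ) ^ 2 * (C₁ ^ 2 * (2 * Real.log (1 / δ) / n)) / (2 * n * C₁ ^ 2) =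
        Real.log (1 / δ) by field_simp, one_div, Real.log_inv, neg_neg, Real.exp_log hδ0]
  rw [hexp] at hdev
  set T := ∫ z : Fin n → X × ℝ, ⨆ j : H × R,
      ∑ i, (∫ x, RcR.clippedLoss M₂ ℓ c j.1.1 j.2.1 x ∂D -
        RcR.clippedLoss M₂ ℓ c j.1.1 j.2.1 (z i)) ∂(Measure.pi fun _ => D)
  refine RcR.exists_event_of_iid hZ hZind hZlaw hδ0.le (p := fun z => ∀ h r : X → ℝ,
    RcR.IsERM z ℓ c H R h r → ENNReal.ofReal (RcR.risk D ℓ c h r - RcR.optRisk D ℓ c H R) ≤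
      ENNReal.ofReal (2 * √2 * L₁) * (RcR.rademacher n D.fst H + RcR.rademacher n D.fst R) +
        ENNReal.ofReal (C₁ * √(2 * Real.log (2 / δ) / n))) ?_
  refine le_trans ?_ ((ENNReal.le_ofReal_iff_toReal_le (measure_ne_top _ _) hδ0.le).2 hdev)
  -- Up to the null set where some response exceeds `M₂` in absolute value, failure of the bound
  -- forces the deviation event.
  refine measure_mono_ae ?_
  filter_upwards [RcR.ae_pi_all hyb n] with z hz
  intro hbad
  by_contra hgood
  refine hbad fun h r herm => ?_
  have hgood' := not_le.1 hgood
  have hexc := (RcR.risk_sub_risk_le_of_isERM habs hyb hn hz herm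
    (⟨⟨h₀, hh₀⟩, ⟨r₀, hr₀⟩⟩ : H × R)).trans_lt hgood'
  have hexc' : RcR.risk D ℓ c h r - RcR.risk D ℓ c h₀ r₀ <
      (n : ℝ)⁻¹ * T + C₁ * √(2 * Real.log (1 / δ) / n) := by
    rw [← mul_lt_mul_iff_right₀ hn', mul_add, mul_inv_cancel_left₀ hn'.ne']
    exact hexc
  calc ENNReal.ofReal (RcR.risk D ℓ c h r - RcR.optRisk D ℓ c H R)
      ≤ ENNReal.ofReal ((n : ℝ)⁻¹ * T + C₁ * √(2 * Real.log (2 / δ) / n)) :=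
        ENNReal.ofReal_le_ofReal (by linarith)
    _ ≤ ENNReal.ofReal ((n : ℝ)⁻¹) * ENNReal.ofReal T +
          ENNReal.ofReal (C₁ * √(2 * Real.log (2 / δ) / n)) := by
        rw [← ENNReal.ofReal_mul (by positivity)]
        exact ENNReal.ofReal_add_le
    _ ≤ ENNReal.ofReal ((n : ℝ)⁻¹) * (2 * (ENNReal.ofReal (√2 * L₁ * n) *
          (RcR.rademacher n D.fst H + RcR.rademacher n D.fst R))) +
          ENNReal.ofReal (C₁ * √(2 * Real.log (2 / δ) / n)) := by gcongr
    _ = _ := by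
        have : ENNReal.ofReal (2 * √2 * L₁) =
            ENNReal.ofReal ((n : ℝ)⁻¹) * (2 * ENNReal.ofReal (√2 * L₁ * n)) := by
          rw [← ENNReal.ofReal_ofNat 2, ← ENNReal.ofReal_mul zero_le_two,
            ← ENNReal.ofReal_mul (by positivity)]
          congr 1
          field_simp
        rw [this]
        simp only [mul_assoc]
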